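/- Let $\mathbb F_q$ be a finite field and let $H_1(D)\in\mathbb F_q[D]^{(n-k_1)\times n}$ and $H_2(D)\in\mathbb F_q[D]^{k_2\times n}$ be parity check matrices of two classical convolutional codes $C_1=(n,k_1)$ and $C_2=(n,n-k_2)$ with $C_2^\perp\subseteq C_1$. Here duality and parity checks refer to the inner product of finitely supported sequences and all their shifts, that is, to $\langle v,w\rangle=\sum_j v_j(D)\,w_j(1/D)$ on $\mathbb F_q[D,D^{-1}]^n$. Assume that both $H_i(D)$ have full row rank and that the encoders $u(D)\mapsto u(D)H_i(D)$ are non-catastrophic (if $u(D)\in\mathbb F_q[[D]]^{r}$ and $u(D)H_i(D)$ is polynomial, then $u(D)$ is polynomial) and delay-free ($H_i(0)$ has full row rank). Let $\mathcal C$ be the quantum convolutional code with stabilizer matrix $$S(D)=(X(D)\,|\,Z(D))=\left(\begin{array}{c|c}H_2(D)&0\\0&H_1(D)\end{array}\right),$$ with frame size $n$ and constraint length $\nu=\sum_i\nu_i$, where $\nu_i$ is the largest degree of an entry of the $i$-th row of $S(D)$. A circuit is a finite sequence of the following generalized Clifford gates, each applied in every frame of the stream, and acting on the columns of $(X(D)|Z(D))$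 as indicated: on qudit $i$ of each frame, the Fourier transform $\left(\begin{smallmatrix}0&-1\\1&0\end{smallmatrix}\right)$, the multiplication gates $\left(\begin{smallmatrix}\gamma^{-1}&0\\0&\gamma\end{smallmatrix}\right)$ with $\gamma\neq0$, and the diagonal gates $\left(\begin{smallmatrix}1&\gamma\\0&1\end{smallmatrix}\right)$; the gate ADD from qudit $i$ of frame $t$ to qudit $j\ne i$ of frame $t+\ell$ (for all $t$), which adds $D^\ell X_i$ to $X_j$ and subtracts $D^{-\ell}Z_j$ from $Z_i$; and the controlled phase gate between qudit $i$ of frame $t$ and qudit $i$ of frame $t+\ell$ (for all $t$; $\ell\ne0$), which adds $(D^\ell+D^{-\ell})X_i$ to $Z_i$. A circuit is an encoding circuit for $\mathcal C$ if it changes the trivial stabilizer matrix $S_0=(0\,|\,I\;0)$, with as many rows as $S(D)$, into a matrix that generates the same stabilizer as $S(D)$, i.e. has the same row span over $\mathbb F_q[D,D^{-1}]$. Its depth on a stream of $N$ frames is the least number of time steps in which all the gates acting on qudits of these $N$ frames can be executed when gates that share a qudit are executed in different time steps and in the order of the circuit (the mutually commuting copies of one controlled phase gate being ordered as follows: first the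 copies whose $t$ has $\lfloor t/|\ell|\rfloor$ even, then the others). Then $\mathcal C$ has an encoding circuit whose depth is bounded independently of the length $N$ of the stream. More precisely, there is a polynomial $p$ in two variables, not depending on the code, on $q$, or on $N$, such that every such code has an encoding circuit whose depth on a stream of $N$ frames is at most $p(n,\nu)$ for all $N$. -/

import Mathlib

open Polynomial LaurentPolynomial

namespace QCC

noncomputable section

/-! ### Classical convolutional codes -/

/-- The delay operator `D` is the variable; the entry `v j` is the (finitely supported) sequence
carried by the `j`-th position of the frames.  The coefficient of `D ^ s` in this Laurent
polynomial is the ordinary inner product of the sequence `v` with the sequence `w` delayed by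
`s` frames. -/
def seqInner {F : Type*} [Field F] {n : ℕ} (v w : Fin n → F[T;T⁻¹]) : F[T;T⁻¹] :=
  ∑ j, v j * LaurentPolynomial.invert (w j)

/-- The convolutional code with parity check matrix `H(D)`: all sequences that are orthogonal to
every row of `H(D)` and to all the shifts of these rows. -/
def parityCode {F : Type*} [Field F] {r n : ℕ} (H : Matrix (Fin r) (Fin n) F[X]) :
    Submodule F[T;T⁻¹] (Fin n → F[T;T⁻¹]) where
  carrier := {c | ∀ i, seqInner (fun j => toLaurent (H i j)) c = 0}
  zero_mem' := by intro i; simp [seqInner]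
  add_mem' := by
    intro a b ha hb i
    have ha' := ha i
    have hb' := hb i
    simp only [seqInner] at ha' hb' ⊢
    simp [mul_add, Finset.sum_add_distrib, ha', hb']
  smul_mem' := by
    intro a c hc i
    have hc' := hc i
    simp only [seqInner] at hc' ⊢
    simp only [Pi.smul_apply, smul_eq_mul, map_mul, mul_left_comm, ← Finset.mul_sum, hc', mul_zero]

/-- The dual code: all sequences orthogonal to every shift of every code sequence. -/
def dualCode {F : Type*} [Field F] {n : ℕ} (C : Submodule F[T;T⁻¹] (Fin n → F[T;T⁻¹])) :
    Submodule F[T;T⁻¹] (Fin n → F[T;T⁻¹]) where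
  carrier := {v | ∀ c ∈ C, seqInner c v = 0}
  zero_mem' := by intro c _; simp [seqInner]
  add_mem' := by
    intro a b ha hb c hc
    have ha' := ha c hc
    have hb' := hb c hc
    simp only [seqInner] at ha' hb' ⊢
    simp [mul_add, Finset.sum_add_distrib, ha', hb']
  smul_mem' := by
    intro a v hv c hc
    have hv' := hv c hc
    simp only [seqInner] at hv' ⊢
    simp only [Pi.smul_apply, smul_eq_mul, map_mul]
    simp_rw [mul_left_comm _ (LaurentPolynomial.invert a)]
    rw [← Finset.mul_sum, hv', mul_zero]

/-- The encoder `u(D) ↦ u(D) G(D)` is non-catastrophic: an information stream whose code stream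
has finite weight (all components are polynomials) has finite weight itself. -/
def NonCatastrophic {F : Type*} [Field F] {r n : ℕ} (G : Matrix (Fin r) (Fin n) F[X]) : Prop :=
  ∀ u : Fin r → PowerSeries F,
    (∀ j, ∃ w : F[X], ∑ i, u i * (G i j : PowerSeries F) = (w : PowerSeries F)) →
      ∀ i, ∃ p : F[X], u i = (p : PowerSeries F)

/-- The encoder `u(D) ↦ u(D) G(D)` is delay-free: `G(0)` has full row rank. -/
def DelayFree {F : Type*} [Field F] {r n : ℕ} (G : Matrix (Fin r) (Fin n) F[X]) : Prop :=
  LinearIndependent F (fun i => fun j => (G i j).eval 0)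

/-- Full row rank of a polynomial matrix. -/
def FullRank {F : Type*} [Field F] {r n : ℕ} (G : Matrix (Fin r) (Fin n) F[X]) : Prop :=
  LinearIndependent F[X] (fun i => G i)

/-! ### Stabilizer matrices `(X(D) | Z(D))`

Columns are indexed by `Fin n ⊕ Fin n`: the left summand is the `X`-part, the right one the
`Z`-part. -/

/-- The stabilizer matrix `(H₂ | 0 ; 0 | H₁)` of the CSS-like construction. -/
def cssStabilizer {F : Type*} [Field F] {n r₁ k₂ : ℕ}
    (H₁ : Matrix (Fin r₁) (Fin n) F[X]) (H₂ : Matrix (Fin k₂) (Fin n) F[X]) :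
    Matrix (Fin k₂ ⊕ Fin r₁) (Fin n ⊕ Fin n) F[X] :=
  Matrix.fromBlocks H₂ 0 0 H₁

/-- The overall constraint length `ν = ∑ i, ν i`, where `ν i` is the largest degree of an entry of
the `i`-th row (over both the `X`-part and the `Z`-part). -/
def constraintLength {F : Type*} [Field F] {n : ℕ} {ρ : Type*} [Fintype ρ]
    (S : Matrix ρ (Fin n ⊕ Fin n) F[X]) : ℕ :=
  ∑ i, Finset.univ.sup fun j => (S i j).natDegree

/-- The `Z`-only stabilizer matrix `S₀ = (0 | I 0)` with `r` rows: the first `r` qudits of every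
frame are ancillae in the state `|0⟩`. -/
def trivialStabilizer (F : Type*) [Field F] (n r : ℕ) :
    Matrix (Fin r) (Fin n ⊕ Fin n) F[T;T⁻¹] :=
  Matrix.of fun i => Sum.elim (fun _ => 0) (fun j => if (i : ℕ) = (j : ℕ) then 1 else 0)

/-- The stabilizer generated by the rows of a matrix and all their shifts, with the Pauli operators
written as vectors `(X(D) | Z(D))`. -/
def stabilizerSpan {F : Type*} [Field F] {n : ℕ} {ρ : Type*}
    (S : Matrix ρ (Fin n ⊕ Fin n) F[T;T⁻¹]) :
    Submodule F[T;T⁻¹] (Fin n ⊕ Fin n → F[T;T⁻¹]) :=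
  Submodule.span F[T;T⁻¹] (Set.range fun i => S i)

/-! ### Generalized Clifford gates and their action on stabilizer matrices -/

/-- The generalized Clifford gates on streams with frame size `n`.  Each of them stands for the
same gate applied in every frame: `add i j ℓ` is the gate `ADD` from qudit `i` of frame `t` to
qudit `j` of frame `t + ℓ`, and `cphase i ℓ` is the controlled phase gate on qudit `i` of frame `t`
and qudit `i` of frame `t + ℓ`, for all `t`. -/
inductive Gate (F : Type*) [Field F] (n : ℕ)
  | dft (i : Fin n) : Gate F n
  | mult (i : Fin n) (γ : Fˣ) : Gate F n
  | phase (i : Fin n) (γ : F) : Gate F n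
  | add (i j : Fin n) (ℓ : ℤ) (h : i ≠ j) : Gate F n
  | cphase (i : Fin n) (ℓ : ℤ) (h : ℓ ≠ 0) : Gate F n

/-- The matrix that acts as `!![a, b; c, d]` on the columns `X i` and `Z i`, and as the identity on
all other columns. -/
def singleQudit {F : Type*} [Field F] {n : ℕ} (i : Fin n) (a b c d : F[T;T⁻¹]) :
    Matrix (Fin n ⊕ Fin n) (Fin n ⊕ Fin n) F[T;T⁻¹] :=
  Matrix.fromBlocks
    (Matrix.diagonal (Function.update 1 i a)) (Matrix.single i i b)
    (Matrix.single i i c) (Matrix.diagonal (Function.update 1 i d))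

/-- The action (from the right) of a gate on the columns of `(X(D) | Z(D))`. -/
def Gate.matrix {F : Type*} [Field F] {n : ℕ} :
    Gate F n → Matrix (Fin n ⊕ Fin n) (Fin n ⊕ Fin n) F[T;T⁻¹]
  | .dft i => singleQudit i 0 (-1) 1 0
  | .mult i γ =>
      singleQudit i (LaurentPolynomial.C ((γ⁻¹ : Fˣ) : F)) 0 0 (LaurentPolynomial.C (γ : F))
  | .phase i γ => singleQudit i 1 (LaurentPolynomial.C γ) 0 1
  | .add i j ℓ _ =>
      Matrix.fromBlocks (1 + Matrix.single i j (LaurentPolynomial.T ℓ)) 0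
        0 (1 - Matrix.single j i (LaurentPolynomial.T (-ℓ)))
  | .cphase i ℓ _ => singleQudit i 1 (LaurentPolynomial.T ℓ + LaurentPolynomial.T (-ℓ)) 0 1

/-- A circuit is a sequence of gates, in the order in which they are applied. -/
abbrev Circuit (F : Type*) [Field F] (n : ℕ) := List (Gate F n)

/-- The action of a circuit on the columns of `(X(D) | Z(D))`. -/
def Circuit.matrix {F : Type*} [Field F] {n : ℕ} (c : Circuit F n) :
    Matrix (Fin n ⊕ Fin n) (Fin n ⊕ Fin n) F[T;T⁻¹] :=
  (c.map Gate.matrix).prod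

/-- `c` is an encoding circuit for the quantum convolutional code with stabilizer matrix `S(D)`:
it changes the stabilizer generated by `S₀ = (0 | I 0)`, which has as many rows as `S(D)`, into the
stabilizer generated by `S(D)`. -/
def Circuit.IsEncoder {F : Type*} [Field F] {n : ℕ} {ρ : Type*} [Fintype ρ] (c : Circuit F n)
    (S : Matrix ρ (Fin n ⊕ Fin n) F[X]) : Prop :=
  stabilizerSpan (trivialStabilizer F n (Fintype.card ρ) * Circuit.matrix c) =
    stabilizerSpan (S.map toLaurent)

/-! ### The circuit on a stream of `N` frames, and its depth -/

/-- The qudit at position `q.2` of frame `q.1`. -/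
abbrev Qudit (n : ℕ) := ℤ × Fin n

/-- Gates on individual qudits of the stream. -/
inductive QuditGate (F : Type*) [Field F] (n : ℕ)
  | dft (q : Qudit n) : QuditGate F n
  | mult (q : Qudit n) (γ : Fˣ) : QuditGate F n
  | phase (q : Qudit n) (γ : F) : QuditGate F n
  | add (q q' : Qudit n) : QuditGate F n
  | cphase (q q' : Qudit n) : QuditGate F n

/-- The qudits on which a gate acts. -/
def QuditGate.support {F : Type*} [Field F] {n : ℕ} : QuditGate F n → Finset (Qudit n)
  | .dft q => {q}
  | .mult q _ => {q}
  | .phase q _ => {q}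
  | .add q q' => {q, q'}
  | .cphase q q' => {q, q'}

/-- The frames `t` of the stream of the `N` frames `0, …, N - 1` for which frame `t + ℓ` belongs to
the stream as well. -/
def framePositions (N : ℕ) (ℓ : ℤ) : List ℤ :=
  ((List.range N).map fun t => (t : ℤ)).filter fun t => decide (0 ≤ t + ℓ ∧ t + ℓ < N)

/-- The gates on individual qudits that make up a gate on a stream of `N` frames.  The copies of
`cphase i ℓ` commute; they are listed such that first come those that start in an even block of `|ℓ|`
consecutive frames, then the others. -/
def Gate.unroll {F : Type*} [Field F] {n : ℕ} (N : ℕ) : Gate F n → List (QuditGate F n)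
  | .dft i => (framePositions N 0).map fun t => .dft (t, i)
  | .mult i γ => (framePositions N 0).map fun t => .mult (t, i) γ
  | .phase i γ => (framePositions N 0).map fun t => .phase (t, i) γ
  | .add i j ℓ _ => (framePositions N ℓ).map fun t => .add (t, i) (t + ℓ, j)
  | .cphase i ℓ _ =>
      (((framePositions N ℓ).filter fun t => decide (Even (t / |ℓ|))) ++
        ((framePositions N ℓ).filter fun t => decide (¬ Even (t / |ℓ|)))).map
          fun t => .cphase (t, i) (t + ℓ, i)

/-- The gates on individual qudits that make up a circuit on a stream of `N` frames, in order. -/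
def Circuit.unroll {F : Type*} [Field F] {n : ℕ} (N : ℕ) (c : Circuit F n) :
    List (QuditGate F n) :=
  c.flatMap (Gate.unroll N)

/-- The gates can be executed in `d` time steps: gates that share a qudit are executed in different
time steps, in the given order. -/
def RunsInTime {F : Type*} [Field F] {n : ℕ} (g : List (QuditGate F n)) (d : ℕ) : Prop :=
  ∃ τ : Fin g.length → Fin d, ∀ a b : Fin g.length, a < b →
    ¬ Disjoint (g.get a).support (g.get b).support → τ a < τ b

/-- The depth: the least number of time steps.  (Always attained: `g.length` steps suffice.) -/
def quditDepth {F : Type*} [Field F] {n : ℕ} (g : List (QuditGate F n)) : ℕ :=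
  sInf {d | RunsInTime g d}

/-- The depth of a circuit on a stream of `N` frames. -/
def Circuit.depth {F : Type*} [Field F] {n : ℕ} (c : Circuit F n) (N : ℕ) : ℕ :=
  quditDepth (Circuit.unroll N c)

end

end QCC

/-!
Column operations that act on the `X`-part and contragrediently on the `Z`-part preserve the inner
product of sequences.  Delays of columns and additions of constant multiples of columns reduce
`H₂(D)` to the coordinate subspace of a set `J₂` of positions: as long as the nonzero columns of
`H₂(D)` have dependent vectors of leading row coefficients, such operations remove a column or lower
the degree of a row, and non-catastrophicity makes the row module saturated, so that it ends up
spanned by unit vectors.  By duality the transformed `H₁(D)` vanishes on `J₂`, so a second reduction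
on the other columns turns it into the coordinate subspace of a set `J₁` disjoint from `J₂`.

Undoing the reductions needs no delays: a delay, pushed through an addition of columns, merely
changes the exponent `ℓ` of the corresponding `ADD` gate.  So the encoder moves the ancillae to the
positions `J₁ ∪ J₂`, applies Fourier transforms on `J₂`, and undoes the two reductions with
multiplication and `ADD` gates.  For each of these gates the copies in different frames act on
disjoint qudits, so the depth is at most the number of gates, which is bounded by the degrees.
-/

namespace QCC

open Matrix

/-! ### Row spans, coordinate submodules and saturation -/

section RowSpan

variable {R ι σ τ : Type*} [CommRing R] [Fintype ι]

/-- The submodule of all linear combinations of the rows of a matrix. -/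
def rowSpan (A : Matrix ι σ R) : Submodule R (σ → R) := LinearMap.range A.vecMulLinear

theorem row_mem_rowSpan (A : Matrix ι σ R) (i : ι) : A i ∈ rowSpan A := by
  classical exact ⟨Pi.single i 1, Matrix.single_one_vecMul i A⟩

theorem map_vecMulLinear_map [Fintype σ] (M : Submodule R (ι → R)) (A : Matrix ι σ R)
    (B : Matrix σ τ R) :
    (M.map A.vecMulLinear).map B.vecMulLinear = M.map (A * B).vecMulLinear := by
  rw [← Submodule.map_comp]
  congr 1
  exact LinearMap.ext fun v => Matrix.vecMul_vecMul v A B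

theorem map_vecMulLinear_one [DecidableEq ι] (M : Submodule R (ι → R)) :
    M.map (1 : Matrix ι ι R).vecMulLinear = M := by
  convert Submodule.map_id M
  exact LinearMap.ext Matrix.vecMul_one

theorem rowSpan_mul [Fintype σ] (A : Matrix ι σ R) (B : Matrix σ τ R) :
    rowSpan (A * B) = (rowSpan A).map B.vecMulLinear := by
  simp only [rowSpan, LinearMap.range_eq_map, map_vecMulLinear_map]

theorem rowSpan_eq_top_of_isUnit [DecidableEq ι] {P : Matrix ι ι R} (hP : IsUnit P) :
    rowSpan P = ⊤ :=
  LinearMap.range_eq_top.2 (Matrix.vecMul_surjective_iff_isUnit.2 hP)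

theorem rowSpan_mul_of_isUnit [DecidableEq ι] {P : Matrix ι ι R} (hP : IsUnit P)
    (A : Matrix ι σ R) : rowSpan (P * A) = rowSpan A := by
  rw [rowSpan_mul, rowSpan_eq_top_of_isUnit hP, rowSpan, LinearMap.range_eq_map]

theorem map_vecMulLinear_injective [DecidableEq ι] {A : Matrix ι ι R} (hA : IsUnit A) :
    Function.Injective (Submodule.map A.vecMulLinear) :=
  Submodule.map_injective_of_injective (Matrix.vecMul_injective_of_isUnit hA)

theorem map_spanSubset [Finite τ] [DecidableEq τ] {A : Matrix ι τ R}
    {s : Set ι} {f : ι → τ} (h : ∀ i ∈ s, ∃ u : Rˣ, A i = u • Pi.single (f i) (1 : R)) :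
    (Pi.spanSubset R s).map A.vecMulLinear = Pi.spanSubset R (f '' s) := by
  classical
  simp only [Pi.spanSubset, Submodule.map_span, Set.image_image, Pi.basisFun_apply,
    Matrix.vecMulLinear_apply, Matrix.single_one_vecMul]
  apply le_antisymm <;> rw [Submodule.span_le] <;> rintro _ ⟨i, hi, rfl⟩ <;>
    obtain ⟨u, hu⟩ := h i hi
  · change A i ∈ _
    rw [hu]
    exact Submodule.smul_mem _ (u : R) (Submodule.subset_span ⟨i, hi, rfl⟩)
  · have : Pi.single (f i) (1 : R) = ((u⁻¹ : Rˣ) : R) • A i := by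
      rw [hu]; exact (inv_smul_smul u _).symm
    simp only [this]
    exact Submodule.smul_mem _ _ (Submodule.subset_span ⟨i, hi, rfl⟩)

end RowSpan

/-- A submodule that contains every vector of which it contains a nonzero multiple; equivalently,
the quotient by it is torsion-free. -/
def Saturated {R V : Type*} [Semiring R] [AddCommMonoid V] [Module R V] (M : Submodule R V) :
    Prop :=
  ∀ ⦃a : R⦄ ⦃v : V⦄, a ≠ 0 → a • v ∈ M → v ∈ M

theorem Saturated.map_vecMulLinear {R ι : Type*} [CommRing R] [Fintype ι] [DecidableEq ι]
    {M : Submodule R (ι → R)} (hM : Saturated M) {A : Matrix ι ι R} (hA : IsUnit A) :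
    Saturated (M.map A.vecMulLinear) := by
  rintro a v ha ⟨m, hm, hmv⟩
  obtain ⟨w, rfl⟩ := Matrix.vecMul_surjective_iff_isUnit.2 hA v
  refine ⟨w, hM ha ?_, rfl⟩
  rwa [← Matrix.vecMul_injective_of_isUnit hA (hmv.trans (Matrix.smul_vecMul a w A).symm)]

/-! ### Contragredient column operations -/

section Contragredient

/-- The column operation that delays the `j`-th column by `a j` frames. -/
noncomputable def delay (F : Type*) {σ : Type*} [CommRing F] [DecidableEq σ] (a : σ → ℤ) :
    Matrix σ σ F[T;T⁻¹] :=
  diagonal fun j => T (a j)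

variable {F σ : Type*} [CommRing F] [DecidableEq σ]

theorem delay_zero : delay F (0 : σ → ℤ) = 1 := by
  simp only [delay, Pi.zero_apply, T_zero, diagonal_one]

variable [Fintype σ]

theorem delay_mul_delay (a b : σ → ℤ) : delay F a * delay F b = delay F (a + b) := by
  simp only [delay, diagonal_mul_diagonal, Pi.add_apply, T_add]

variable {U V U' V' : Matrix σ σ F[T;T⁻¹]}

/-- Two matrices acting on row vectors such that `V(D)` is the inverse transpose of `U(1/D)`; if
`U` acts on the `X`-part, then `V` acts on the `Z`-part. -/
def IsContragredient (U V : Matrix σ σ F[T;T⁻¹]) : Prop :=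
  U * (V.map LaurentPolynomial.invert)ᵀ = 1

theorem IsContragredient.isUnit (h : IsContragredient U V) : IsUnit U :=
  IsUnit.of_mul_eq_one _ h

theorem isContragredient_one : IsContragredient (1 : Matrix σ σ F[T;T⁻¹]) 1 := by
  simp [IsContragredient]

theorem IsContragredient.mul (h : IsContragredient U V) (h' : IsContragredient U' V') :
    IsContragredient (U * U') (V * V') := by
  rw [IsContragredient, Matrix.map_mul, Matrix.transpose_mul, mul_assoc, ← mul_assoc U', h',
    one_mul, h]

theorem isContragredient_transvection {i j : σ} (hij : i ≠ j) (f : F[T;T⁻¹]) :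
    IsContragredient (transvection i j f) (transvection j i (-LaurentPolynomial.invert f)) := by
  have : ((transvection j i (-LaurentPolynomial.invert f)).map LaurentPolynomial.invert)ᵀ =
      transvection i j (-f) := by
    rw [transvection, Matrix.map_add _ (map_add _), Matrix.map_one _ (map_zero _) (map_one _),
      Matrix.map_single, Matrix.transpose_add, Matrix.transpose_one, Matrix.transpose_single,
      map_neg, LaurentPolynomial.involutive_invert, transvection]
  rw [IsContragredient, this, transvection_mul_transvection_same _ _ hij]
  simp

theorem isContragredient_delay (a : σ → ℤ) : IsContragredient (delay F a) (delay F a) := by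
  rw [IsContragredient, delay, diagonal_map (map_zero _), diagonal_transpose,
    diagonal_mul_diagonal, ← diagonal_one]
  simp only [invert_T, ← T_add, add_neg_cancel, T_zero]

theorem map_delay_spanSubset (a : σ → ℤ) (s : Set σ) :
    (Pi.spanSubset F[T;T⁻¹] s).map (delay F a).vecMulLinear = Pi.spanSubset F[T;T⁻¹] s := by
  have h := map_spanSubset (A := delay F a) (s := s) (f := id) fun i _ =>
    ⟨(isUnit_T (R := F) (a i)).unit, by
      ext j; simp [delay, Matrix.diagonal_apply, Pi.single_apply, eq_comm, Units.smul_def]⟩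
  rwa [Set.image_id] at h

end Contragredient

theorem IsContragredient.seqInner_vecMul {F : Type*} [Field F] {n : ℕ}
    {U V : Matrix (Fin n) (Fin n) F[T;T⁻¹]} (h : IsContragredient U V)
    (v w : Fin n → F[T;T⁻¹]) : seqInner (v ᵥ* U) (w ᵥ* V) = seqInner v w := by
  have hw : LaurentPolynomial.invert ∘ (w ᵥ* V) =
      (V.map LaurentPolynomial.invert)ᵀ *ᵥ (LaurentPolynomial.invert ∘ w) := by
    rw [Matrix.mulVec_transpose]
    exact funext (RingHom.map_vecMul (LaurentPolynomial.invert (R := F)).toRingEquiv.toRingHom V w)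
  change (v ᵥ* U) ⬝ᵥ (LaurentPolynomial.invert ∘ (w ᵥ* V)) = v ⬝ᵥ (LaurentPolynomial.invert ∘ w)
  rw [hw, Matrix.dotProduct_mulVec, Matrix.vecMul_vecMul, h, Matrix.vecMul_one]

/-! ### Column reductions -/

section ColumnReduction

variable {F : Type*} [CommRing F] {n : ℕ}

/-- `ColumnReduction J N K U V` says that the contragredient pair `(U, V)` is a product of at most
`N` additions of a constant multiple of one column in `J` to another one, and of delays of columns
by at most `K` frames in total. -/
inductive ColumnReduction (J : Finset (Fin n)) :
    ℕ → ℕ → Matrix (Fin n) (Fin n) F[T;T⁻¹] → Matrix (Fin n) (Fin n) F[T;T⁻¹] → Prop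
  | one (N K : ℕ) : ColumnReduction J N K 1 1
  | transvection_mul {N K : ℕ} {U V : Matrix (Fin n) (Fin n) F[T;T⁻¹]} {i j : Fin n}
      (hi : i ∈ J) (hj : j ∈ J) (hij : i ≠ j) (c : F) (h : ColumnReduction J N K U V) :
      ColumnReduction J (N + 1) K (transvection i j (LaurentPolynomial.C c) * U)
        (transvection j i (LaurentPolynomial.C (-c)) * V)
  | delay_mul {N K : ℕ} {U V : Matrix (Fin n) (Fin n) F[T;T⁻¹]} (a : Fin n → ℤ)
      (h : ColumnReduction J N K U V) :
      ColumnReduction J N (K + ∑ j, (a j).natAbs) (delay F a * U) (delay F a * V)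

namespace ColumnReduction

variable {J J' : Finset (Fin n)} {N N' K K' : ℕ} {U V U' V' : Matrix (Fin n) (Fin n) F[T;T⁻¹]}

theorem mono (h : ColumnReduction J N K U V) (hJ : J ⊆ J') (hN : N ≤ N') (hK : K ≤ K') :
    ColumnReduction J' N' K' U V := by
  induction h generalizing N' K' with
  | one => exact one N' K'
  | transvection_mul hi hj hij c _ ih =>
    obtain ⟨N', rfl⟩ := Nat.exists_eq_succ_of_ne_zero (Nat.ne_zero_of_lt hN)
    exact transvection_mul (hJ hi) (hJ hj) hij c (ih (Nat.succ_le_succ_iff.1 hN) hK)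
  | delay_mul a _ ih =>
    obtain ⟨K', rfl⟩ := Nat.exists_eq_add_of_le' ((Nat.le_add_left _ _).trans hK)
    exact delay_mul a (ih hN (Nat.le_of_add_le_add_right hK))

theorem mul (h : ColumnReduction J N K U V) (h' : ColumnReduction J N' K' U' V') :
    ColumnReduction J (N + N') (K + K') (U * U') (V * V') := by
  induction h with
  | one N K =>
    simpa only [one_mul] using h'.mono subset_rfl (Nat.le_add_left N' N) (Nat.le_add_left K' K)
  | transvection_mul hi hj hij c _ ih =>
    simpa only [mul_assoc, Nat.add_right_comm] using transvection_mul hi hj hij c ih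
  | delay_mul a _ ih =>
    simpa only [mul_assoc, Nat.add_right_comm] using delay_mul a ih

protected theorem delay (J : Finset (Fin n)) (a : Fin n → ℤ) :
    ColumnReduction J 0 (∑ j, (a j).natAbs) (delay F a) (delay F a) := by
  simpa only [mul_one, zero_add] using delay_mul a (one (J := J) 0 0)

theorem symm (h : ColumnReduction J N K U V) : ColumnReduction J N K V U := by
  induction h with
  | one N K => exact one N K
  | transvection_mul hi hj hij c _ ih =>
    simpa only [neg_neg] using transvection_mul hj hi hij.symm (-c) ih
  | delay_mul a _ ih => exact delay_mul a ih

theorem isContragredient (h : ColumnReduction J N K U V) : IsContragredient U V := by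
  induction h with
  | one => exact isContragredient_one
  | transvection_mul _ _ hij c _ ih =>
    simpa using (isContragredient_transvection hij (LaurentPolynomial.C c)).mul ih
  | delay_mul a _ ih => exact (isContragredient_delay a).mul ih

theorem isUnit (h : ColumnReduction J N K U V) : IsUnit U := h.isContragredient.isUnit

theorem map_spanSubset_of_disjoint (h : ColumnReduction J N K U V) {I : Finset (Fin n)}
    (hI : Disjoint I J) :
    (Pi.spanSubset F[T;T⁻¹] (I : Set (Fin n))).map U.vecMulLinear = Pi.spanSubset F[T;T⁻¹] I := by
  induction h with
  | one => exact map_vecMulLinear_one _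
  | @transvection_mul _ _ _ _ i j hi _ _ c _ ih =>
    have hrow : ∀ k ∈ (I : Set (Fin n)), ∃ u : F[T;T⁻¹]ˣ,
        Matrix.transvection i j (LaurentPolynomial.C c) k = u • Pi.single k 1 := fun k hk =>
      ⟨1, by
        have hik : i ≠ k := fun h => Finset.disjoint_left.1 hI hk (h ▸ hi)
        ext l; simp [Matrix.transvection, hik, Matrix.one_apply, Pi.single_apply, eq_comm]⟩
    rw [← map_vecMulLinear_map, map_spanSubset (f := id) hrow, Set.image_id, ih]
  | delay_mul a _ ih => rw [← map_vecMulLinear_map, map_delay_spanSubset, ih]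

end ColumnReduction

end ColumnReduction

theorem one_add_vecMulVec_mul {R σ : Type*} [CommRing R] [Fintype σ] [DecidableEq σ]
    {b e : σ → R} (h : e ⬝ᵥ b = 0) (a f : σ → R) :
    (1 + vecMulVec a e) * (1 + vecMulVec b f) = 1 + (vecMulVec a e + vecMulVec b f) := by
  rw [mul_add, mul_one, add_mul, one_mul, vecMulVec_mul_vecMulVec, h, zero_smul, vecMulVec_zero,
    add_zero, add_assoc]

theorem transvection_mul_eq_one_add_vecMulVec {R σ : Type*} [CommRing R] [DecidableEq σ]
    (i j : σ) (a b : R) :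
    transvection i j (a * b) = 1 + vecMulVec (Pi.single i a) (Pi.single j b) := by
  ext k l
  by_cases hk : i = k <;> by_cases hl : j = l <;>
    simp [transvection, vecMulVec_apply, hk, hl, eq_comm]

theorem map_transvection {R S σ : Type*} [CommRing R] [CommRing S] [DecidableEq σ]
    (f : R →+* S) (i j : σ) (c : R) : (transvection i j c).map f = transvection i j (f c) := by
  rw [transvection, Matrix.map_add _ (map_add f), Matrix.map_one _ (map_zero f) (map_one f),
    Matrix.map_single, transvection]

section ColumnReduction

variable {F : Type*} [CommRing F] {n : ℕ}

theorem ColumnReduction.one_add_vecMulVec {J s : Finset (Fin n)} (hs : s ⊆ J)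
    {j₀ : Fin n} (hj₀ : j₀ ∈ J) (hj₀s : j₀ ∉ s) (c : Fin n → F) (hc : ∀ i ∉ s, c i = 0) :
    ColumnReduction J s.card 0 ((1 + vecMulVec c (Pi.single j₀ 1)).map LaurentPolynomial.C)
      ((1 + vecMulVec (Pi.single j₀ 1) (-c)).map LaurentPolynomial.C) := by
  induction s using Finset.induction_on generalizing c with
  | empty =>
    obtain rfl : c = 0 := funext fun i => hc i (Finset.notMem_empty i)
    simpa [Matrix.map_one] using ColumnReduction.one 0 0
  | @insert i s hi ih =>
    have hij₀ : i ≠ j₀ := fun h => hj₀s (h ▸ Finset.mem_insert_self i s)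
    have hjs : j₀ ∉ s := fun h => hj₀s (Finset.mem_insert_of_mem h)
    set c' := Function.update c i 0
    have hc' : ∀ k ∉ s, c' k = 0 := fun k hk => by
      by_cases hki : k = i
      · simp [c', hki]
      · simpa [c', hki] using hc k (by simp [hki, hk])
    have hsum : c = Pi.single i (c i) + c' := by
      ext k; by_cases hki : k = i <;> simp [c', hki]
    have hX : 1 + vecMulVec c (Pi.single j₀ 1) =
        Matrix.transvection i j₀ (c i) * (1 + vecMulVec c' (Pi.single j₀ 1)) := by
      rw [← mul_one (c i), transvection_mul_eq_one_add_vecMulVec,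
        one_add_vecMulVec_mul (by simp [hc' j₀ hjs]), ← add_vecMulVec, ← hsum]
    have hZ : 1 + vecMulVec (Pi.single j₀ 1) (-c) =
        Matrix.transvection j₀ i (-c i) * (1 + vecMulVec (Pi.single j₀ 1) (-c')) := by
      rw [← one_mul (-c i), transvection_mul_eq_one_add_vecMulVec,
        one_add_vecMulVec_mul (by simp [hij₀]), ← vecMulVec_add, Pi.single_neg, ← neg_add, ← hsum]
    rw [Finset.card_insert_of_notMem hi, hX, hZ, Matrix.map_mul, Matrix.map_mul,
      map_transvection, map_transvection]
    exact transvection_mul (hs (Finset.mem_insert_self i s)) hj₀ hij₀ (c i)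
      (ih (fun k hk => hs (Finset.mem_insert_of_mem hk)) hjs c' hc')

end ColumnReduction

/-! ### Reducing a polynomial matrix -/

instance isPrincipalIdealRing_laurentPolynomial {F : Type*} [Field F] :
    IsPrincipalIdealRing F[T;T⁻¹] where
  principal I := by
    obtain ⟨p, hp⟩ := IsPrincipalIdealRing.principal (I.under F[X])
    refine ⟨algebraMap F[X] F[T;T⁻¹] p, ?_⟩
    rw [← IsLocalization.map_under (Submonoid.powers (X : F[X])) _ I, hp, Ideal.submodule_span_eq,
      Ideal.map_span, Set.image_singleton, Ideal.submodule_span_eq]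

theorem Saturated.exists_dual_apply_ne_zero {R V : Type*} [CommRing R] [IsDomain R]
    [IsPrincipalIdealRing R] [AddCommGroup V] [Module R V] [Module.Finite R V]
    {M : Submodule R V} (hM : Saturated M) {v : V} (hv : v ∉ M) :
    ∃ φ : Module.Dual R V, (∀ m ∈ M, φ m = 0) ∧ φ v ≠ 0 := by
  have : Module.IsTorsionFree R (V ⧸ M) := Module.IsTorsionFree.of_smul_eq_zero fun a x hax => by
    obtain ⟨w, rfl⟩ := M.mkQ_surjective x
    rw [← map_smul] at hax
    simp only [Submodule.mkQ_apply, Submodule.Quotient.mk_eq_zero] at hax ⊢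
    exact or_iff_not_imp_left.2 fun ha => hM ha hax
  have hv' : M.mkQ v ≠ 0 := by simpa
  obtain ⟨φ, hφ⟩ := not_forall.1 (mt (Module.forall_dual_apply_eq_zero_iff R _).1 hv')
  exact ⟨φ ∘ₗ M.mkQ, fun m hm => by simp [(Submodule.Quotient.mk_eq_zero M).2 hm], hφ⟩

theorem exists_toLaurent_eq_T_smul {F σ : Type*} [CommRing F] [Finite σ] (v : σ → F[T;T⁻¹]) :
    ∃ (N : ℕ) (p : σ → F[X]), ∀ j, toLaurent (p j) = T N * v j := by
  obtain ⟨⟨_, N, rfl⟩, hN⟩ :=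
    IsLocalization.exist_integer_multiples_of_finite (Submonoid.powers (X : F[X])) v
  choose p hp using hN
  refine ⟨N, p, fun j => (hp j).trans ?_⟩
  rw [Algebra.smul_def, algebraMap_eq_toLaurent, map_pow, toLaurent_X, T_pow, mul_one]

/-- The `i`-th row of the matrix consists of the coefficients of `D ^ d i` in the `i`-th row of a
polynomial matrix; they are its leading coefficients if `d i` is the degree of that row. -/
def coeffMatrix {F ι σ : Type*} [Semiring F] (H : Matrix ι σ F[X]) (d : ι → ℕ) : Matrix ι σ F :=
  of fun i j => (H i j).coeff (d i)

section CoeffMatrix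

variable {F ι σ : Type*} [Fintype σ] {d : ι → ℕ} {J : Set σ}

theorem eq_zero_of_mulVec_eq_zero_of_coeffMatrix [CommRing F] {H : Matrix ι σ F[X]}
    (hd : ∀ i j, (H i j).natDegree ≤ d i)
    (hlead : ∀ a : σ → F, (∀ j ∉ J, a j = 0) → coeffMatrix H d *ᵥ a = 0 → a = 0)
    {q : σ → F[X]} (hq : ∀ j ∉ J, q j = 0) (hHq : H *ᵥ q = 0) : q = 0 := by
  by_contra hne
  obtain ⟨j₀, hj₀⟩ := Function.ne_iff.1 hne
  obtain ⟨j₁, -, hmax⟩ := Finset.exists_max_image Finset.univ (fun j => (q j).degree)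
    ⟨j₀, Finset.mem_univ j₀⟩
  have ha := hlead (fun j => (q j).coeff (q j₁).natDegree) (fun j hj => by simp [hq j hj]) ?_
  · have : q j₁ = 0 := Polynomial.leadingCoeff_eq_zero.1 (congrFun ha j₁)
    refine hj₀ (Polynomial.degree_eq_bot.1 (le_bot_iff.1 ((hmax j₀ (Finset.mem_univ _)).trans ?_)))
    rw [this, Polynomial.degree_zero]
  · ext i
    have h := congrArg (Polynomial.coeff · (d i + (q j₁).natDegree)) (congrFun hHq i)
    simp only [mulVec, dotProduct, Polynomial.finsetSum_coeff, Pi.zero_apply,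
      Polynomial.coeff_zero] at h
    refine (Finset.sum_congr rfl fun j _ => ?_).trans h
    exact (Polynomial.coeff_mul_add_eq_of_natDegree_le (hd i j)
      (Polynomial.natDegree_le_natDegree (hmax j (Finset.mem_univ j)))).symm

theorem rowSpan_eq_spanSubset_of_coeffMatrix [Field F] [Fintype ι] {H : Matrix ι σ F[X]}
    (hd : ∀ i j, (H i j).natDegree ≤ d i)
    (hJ : ∀ i, ∀ j ∉ J, H i j = 0) (hsat : Saturated (rowSpan (H.map toLaurent)))
    (hlead : ∀ a : σ → F, (∀ j ∉ J, a j = 0) → coeffMatrix H d *ᵥ a = 0 → a = 0) :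
    rowSpan (H.map toLaurent) = Pi.spanSubset F[T;T⁻¹] J := by
  classical
  apply le_antisymm
  · rintro _ ⟨u, rfl⟩
    rw [Pi.mem_spanSubset_iff]
    intro j hj
    simp [vecMul, dotProduct, hJ _ j hj]
  intro v hv
  by_contra hvM
  obtain ⟨φ, hφM, hφv⟩ := hsat.exists_dual_apply_ne_zero hvM
  obtain ⟨N, q, hq⟩ := exists_toLaurent_eq_T_smul fun j =>
    if j ∈ J then φ (Pi.single j 1) else 0
  have hφ : ∀ w : σ → F[T;T⁻¹], (∀ j ∉ J, w j = 0) →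
      T N * φ w = ∑ j, w j * toLaurent (q j) := fun w hw => by
    conv_lhs => rw [pi_eq_sum_univ' w, map_sum, Finset.mul_sum]
    refine Finset.sum_congr rfl fun j _ => ?_
    by_cases hj : j ∈ J
    · simp only [map_smul, smul_eq_mul, hq, if_pos hj, mul_left_comm]
    · simp [hw j hj]
  have hq0 : q = 0 := eq_zero_of_mulVec_eq_zero_of_coeffMatrix hd hlead (q := q)
    (fun j hj => Polynomial.toLaurent_injective (by simp [hq, hj])) <| funext fun i =>
      Polynomial.toLaurent_injective <| by
        simpa [mulVec, dotProduct, hφM _ (row_mem_rowSpan (H.map toLaurent) i)] using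
          (hφ (H.map toLaurent i) fun j hj => by simp [hJ i j hj]).symm
  refine hφv ((isUnit_T (R := F) (N : ℤ)).mul_right_eq_zero.1 ?_)
  rw [hφ v (Pi.mem_spanSubset_iff.1 hv), hq0]
  simp

end CoeffMatrix

section PolynomialMatrix

variable {F ι σ : Type*} [CommRing F]

theorem map_toLaurent_mul_map_C [Fintype σ] (H : Matrix ι σ F[X]) (Q : Matrix σ σ F) :
    H.map toLaurent * Q.map LaurentPolynomial.C = (H * Q.map Polynomial.C).map toLaurent := by
  rw [Matrix.map_mul, Matrix.map_map]
  congr 2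
  exact funext fun c => (Polynomial.toLaurent_C c).symm

theorem coeffMatrix_mul_map_C [Fintype σ] (H : Matrix ι σ F[X]) (d : ι → ℕ) (Q : Matrix σ σ F) :
    coeffMatrix (H * Q.map Polynomial.C) d = coeffMatrix H d * Q := by
  ext i j
  simp [coeffMatrix, mul_apply]

theorem natDegree_mul_map_C_le [Fintype σ] {H : Matrix ι σ F[X]} {d : ι → ℕ}
    (hd : ∀ i j, (H i j).natDegree ≤ d i) (Q : Matrix σ σ F) (i : ι) (j : σ) :
    ((H * Q.map Polynomial.C) i j).natDegree ≤ d i := by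
  rw [mul_apply]
  exact Polynomial.natDegree_sum_le_of_forall_le _ _ fun k _ =>
    (Polynomial.natDegree_mul_C_le _ _).trans (hd i k)

theorem map_toLaurent_mul_delay [Fintype σ] [DecidableEq σ] {H : Matrix ι σ F[X]} {j₀ : σ}
    {ℓ : ℤ} {g : ι → F[X]} (hg : ∀ i, toLaurent (g i) = toLaurent (H i j₀) * T ℓ) :
    H.map toLaurent * delay F (Pi.single j₀ ℓ) = (H.updateCol j₀ g).map toLaurent := by
  ext1 i j
  by_cases hj : j = j₀
  · subst hj; simp [delay, hg]
  · simp [delay, hj]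

theorem exists_eq_X_pow_mul {p : ι → F[X]} (hp : p ≠ 0) :
    ∃ (s : ℕ) (g : ι → F[X]) (k : ι), (∀ i, p i = g i * X ^ s) ∧ (g k).coeff 0 ≠ 0 := by
  obtain ⟨k, hk, hmin⟩ := exists_minimalFor_of_wellFoundedLT (fun i => p i ≠ 0)
    (fun i => (p i).natTrailingDegree) (Function.ne_iff.1 hp)
  have hdvd : ∀ i, X ^ (p k).natTrailingDegree ∣ p i := fun i =>
    Polynomial.X_pow_dvd_iff.2 fun m hm => by
      by_cases hi : p i = 0
      · rw [hi, Polynomial.coeff_zero]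
      · exact Polynomial.coeff_eq_zero_of_lt_natTrailingDegree
          (hm.trans_le (le_of_not_gt fun h => h.not_ge (hmin hi h.le)))
  choose g hg using hdvd
  refine ⟨(p k).natTrailingDegree, g, k, fun i => (hg i).trans (mul_comm _ _), fun h0 => ?_⟩
  rw [← Polynomial.coeff_X_pow_mul (g k) (p k).natTrailingDegree, ← hg, zero_add] at h0
  exact hk (Polynomial.trailingCoeff_eq_zero.1 h0)

theorem rowSpan_updateRow_divX [Fintype ι] [DecidableEq ι] {H : Matrix ι σ F[X]} {k : ι}
    (hk : ∀ j, (H k j).coeff 0 = 0) :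
    rowSpan ((H.updateRow k fun j => (H k j).divX).map toLaurent) = rowSpan (H.map toLaurent) := by
  have hT : IsUnit (diagonal (Pi.mulSingle k (T 1 : F[T;T⁻¹]))) := by
    refine Matrix.isUnit_diagonal.2 (Pi.isUnit_iff.2 fun i => ?_)
    by_cases hi : i = k
    · rw [hi, Pi.mulSingle_eq_same]
      exact isUnit_T 1
    · rw [Pi.mulSingle_eq_of_ne hi]
      exact isUnit_one
  rw [← rowSpan_mul_of_isUnit hT]
  congr 1
  ext1 i j
  by_cases hi : i = k
  · subst hi
    have h := Polynomial.divX_mul_X_add (H i j)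
    rw [hk j, map_zero, add_zero] at h
    conv_rhs => rw [Matrix.map_apply, ← h]
    simp
  · simp [hi]

end PolynomialMatrix

theorem mul_map_C_one_add_vecMulVec {F ι σ : Type*} [CommRing F] [Fintype σ] [DecidableEq σ]
    (H : Matrix ι σ F[X]) (a b : σ → F) :
    H * (1 + vecMulVec a b).map Polynomial.C =
      H + vecMulVec (H *ᵥ (Polynomial.C ∘ a)) (Polynomial.C ∘ b) := by
  have : (1 + vecMulVec a b).map Polynomial.C =
      1 + vecMulVec (Polynomial.C ∘ a) (Polynomial.C ∘ b) := by
    rw [Matrix.map_add _ (map_add _), Matrix.map_one _ (map_zero _) (map_one _)]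
    congr 1
    ext1 i j
    simp [vecMulVec_apply]
  rw [this, Matrix.mul_add, Matrix.mul_one, mul_vecMulVec]

section ColumnElimination

variable {F ι : Type*} [Field F] {n : ℕ} {H : Matrix ι (Fin n) F[X]} {J : Finset (Fin n)}

theorem exists_coeffMatrix_col_eq_zero {d : ι → ℕ} (hJ : ∀ i, ∀ j ∉ J, H i j = 0) {a : Fin n → F}
    (haJ : ∀ j ∉ J, a j = 0) (ha : a ≠ 0) (hlead : coeffMatrix H d *ᵥ a = 0) :
    ∃ j₀ ∈ J, ∃ Q Q' : Matrix (Fin n) (Fin n) F,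
      ColumnReduction J J.card 0 (Q.map LaurentPolynomial.C) (Q'.map LaurentPolynomial.C) ∧
      (∀ i, ∀ j ∉ J, (H * Q.map Polynomial.C) i j = 0) ∧
      ∀ i, coeffMatrix (H * Q.map Polynomial.C) d i j₀ = 0 := by
  obtain ⟨j₀, hj₀⟩ := Function.ne_iff.1 ha
  have hj₀J : j₀ ∈ J := by_contra fun h => hj₀ (haJ j₀ h)
  set e : Fin n → F := Pi.single j₀ 1
  set c : Fin n → F := (a j₀)⁻¹ • a - e with hc
  have hcJ : ∀ j ∉ J.erase j₀, c j = 0 := fun j hj => by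
    by_cases hjj : j = j₀
    · subst hjj; simp [hc, e, inv_mul_cancel₀ hj₀]
    · simp [hc, e, hjj, haJ j fun h => hj (Finset.mem_erase.2 ⟨hjj, h⟩)]
  refine ⟨j₀, hj₀J, 1 + vecMulVec c e, 1 + vecMulVec e (-c),
    (ColumnReduction.one_add_vecMulVec (Finset.erase_subset j₀ J) hj₀J (Finset.notMem_erase j₀ J)
      c hcJ).mono subset_rfl (Finset.card_le_card (Finset.erase_subset j₀ J)) le_rfl,
    fun i j hj => ?_, fun i => ?_⟩
  · have hjj : j ≠ j₀ := fun h => hj (h ▸ hj₀J)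
    rw [mul_map_C_one_add_vecMulVec]
    simp [vecMulVec_apply, hJ i j hj, e, hjj]
  · rw [coeffMatrix_mul_map_C, Matrix.mul_add, Matrix.mul_one, mul_vecMulVec, hc,
      mulVec_sub, mulVec_smul, hlead, smul_zero, zero_sub]
    simp [vecMulVec_apply, e]

theorem exists_coeff_zero_row_eq_zero (hJ : ∀ i, ∀ j ∉ J, H i j = 0) {k : ι} {j₀ : Fin n}
    (hj₀ : j₀ ∈ J) (hk : (H k j₀).coeff 0 ≠ 0) :
    ∃ Q Q' : Matrix (Fin n) (Fin n) F,
      ColumnReduction J J.card 0 (Q.map LaurentPolynomial.C) (Q'.map LaurentPolynomial.C) ∧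
      (∀ i, ∀ j ∉ J, (H * Q.map Polynomial.C) i j = 0) ∧
      (∀ i, (H * Q.map Polynomial.C) i j₀ = H i j₀) ∧
      ∀ j ≠ j₀, ((H * Q.map Polynomial.C) k j).coeff 0 = 0 := by
  set e : Fin n → F := Pi.single j₀ 1
  set c : Fin n → F := Function.update (fun j => (H k j).coeff 0 / (H k j₀).coeff 0) j₀ 0 with hc
  have hcJ : ∀ j ∉ J.erase j₀, c j = 0 := fun j hj => by
    by_cases hjj : j = j₀
    · subst hjj; simp [hc]
    · simp [hc, hjj, hJ k j fun h => hj (Finset.mem_erase.2 ⟨hjj, h⟩)]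
  have hmul : ∀ i j, (H * (1 + vecMulVec e (-c)).map Polynomial.C) i j =
      H i j - H i j₀ * Polynomial.C (c j) := fun i j => by
    have he : Polynomial.C ∘ e = Pi.single j₀ 1 := by
      ext1 l; simp [e, Pi.single_apply, apply_ite]
    rw [mul_map_C_one_add_vecMulVec, he]
    simp [vecMulVec_apply, sub_eq_add_neg]
  refine ⟨1 + vecMulVec e (-c), 1 + vecMulVec c e,
    (ColumnReduction.one_add_vecMulVec (Finset.erase_subset j₀ J) hj₀ (Finset.notMem_erase j₀ J)
      c hcJ).symm.mono subset_rfl (Finset.card_le_card (Finset.erase_subset j₀ J)) le_rfl,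
    fun i j hj => ?_, fun i => ?_, fun j hj => ?_⟩
  · rw [hmul, hJ i j hj, hcJ j fun h => hj (Finset.mem_of_mem_erase h), map_zero, mul_zero,
      sub_zero]
  · rw [hmul, hcJ j₀ (Finset.notMem_erase j₀ J), map_zero, mul_zero, sub_zero]
  · rw [hmul, Polynomial.coeff_sub, Polynomial.coeff_mul_C, hc, Function.update_of_ne hj,
      mul_div_cancel₀ _ hk, sub_self]

end ColumnElimination

theorem natDegree_add_lt_of_coeff_eq_zero {R : Type*} [Semiring R] [Nontrivial R] {p g : R[X]}
    {s d : ℕ} (hp : p = g * X ^ s) (hd : p.natDegree ≤ d) (hcoeff : p.coeff d = 0) (hg : g ≠ 0) :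
    g.natDegree + s < d := by
  rw [hp, Polynomial.natDegree_mul_X_pow s hg] at hd
  refine lt_of_le_of_ne hd fun h => hg (Polynomial.leadingCoeff_eq_zero.1 ?_)
  rw [Polynomial.leadingCoeff, ← Polynomial.coeff_mul_X_pow, h, ← hp, hcoeff]

theorem natDegree_updateCol_le {R ι σ : Type*} [Semiring R] [DecidableEq σ] {H : Matrix ι σ R[X]}
    {d : ι → ℕ} (hd : ∀ i j, (H i j).natDegree ≤ d i) (j₀ : σ) {g : ι → R[X]}
    (hg : ∀ i, (g i).natDegree ≤ d i) (i : ι) (j : σ) :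
    (H.updateCol j₀ g i j).natDegree ≤ d i := by
  rw [updateCol_apply]
  split_ifs
  exacts [hg i, hd i j]

section Reduction

variable {F ι : Type*} [Field F] [Fintype ι] {n : ℕ} {H : Matrix ι (Fin n) F[X]} {d : ι → ℕ}
  {J : Finset (Fin n)}

theorem exists_rowSpan_eq_of_coeff_zero_eq_zero {G : Matrix ι (Fin n) F[X]}
    (hd : ∀ i j, (G i j).natDegree ≤ d i) (hJ : ∀ i, ∀ j ∉ J, G i j = 0) {k : ι}
    (hdk : 0 < d k) (hk : ∀ j, (G k j).coeff 0 = 0) :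
    ∃ (H' : Matrix ι (Fin n) F[X]) (d' : ι → ℕ), (∀ i j, (H' i j).natDegree ≤ d' i) ∧
      (∀ i, ∀ j ∉ J, H' i j = 0) ∧ ∑ i, d' i + 1 = ∑ i, d i ∧
      rowSpan (H'.map toLaurent) = rowSpan (G.map toLaurent) := by
  classical
  refine ⟨G.updateRow k fun j => (G k j).divX, Function.update d k (d k - 1), fun i j => ?_,
    fun i j hj => ?_, ?_, rowSpan_updateRow_divX hk⟩
  · by_cases hi : i = k
    · simpa [hi, Polynomial.natDegree_divX_eq_natDegree_tsub_one] using
        Nat.sub_le_sub_right (hd k j) 1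
    · simpa [hi] using hd i j
  · by_cases hi : i = k
    · simp [hi, hJ k j hj]
    · simp [hi, hJ i j hj]
  · rw [Finset.sum_update_of_mem (Finset.mem_univ k), add_right_comm, Nat.sub_add_cancel hdk,
      ← Finset.add_sum_erase _ d (Finset.mem_univ k), Finset.sdiff_singleton_eq_erase]

/-- Delaying column `j₀` by `-s` frames makes one of its constant terms nonzero; with it, the other
constant terms of that row can be cleared.  After delaying column `j₀` by `1` frame, which respects
the bounds on the degrees by `hlow`, the whole row is divisible by `D`. -/
theorem exists_degree_reduction (hd : ∀ i j, (H i j).natDegree ≤ d i)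
    (hJ : ∀ i, ∀ j ∉ J, H i j = 0) {j₀ : Fin n} (hj₀ : j₀ ∈ J)
    (hlow : ∀ i, coeffMatrix H d i j₀ = 0) (hne : (fun i => H i j₀) ≠ 0) :
    ∃ U V, ColumnReduction J J.card (∑ i, d i) U V ∧
      ∃ (H' : Matrix ι (Fin n) F[X]) (d' : ι → ℕ), (∀ i j, (H' i j).natDegree ≤ d' i) ∧
        (∀ i, ∀ j ∉ J, H' i j = 0) ∧ ∑ i, d' i + 1 = ∑ i, d i ∧
        (rowSpan (H.map toLaurent)).map U.vecMulLinear = rowSpan (H'.map toLaurent) := by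
  obtain ⟨s, g, k, hg, hgk⟩ := exists_eq_X_pow_mul hne
  have hdeg : ∀ i, g i ≠ 0 → (g i).natDegree + s < d i := fun i =>
    natDegree_add_lt_of_coeff_eq_zero (hg i) (hd i j₀) (hlow i)
  have hdk := hdeg k fun h => hgk (by rw [h, Polynomial.coeff_zero])
  have hne₀ : ∀ j ∉ J, j ≠ j₀ := fun j hj h => hj (h ▸ hj₀)
  obtain ⟨Q, Q', hQ, hQJ, hQj₀, hQk⟩ := exists_coeff_zero_row_eq_zero
    (H := H.updateCol j₀ g) (fun i j hj => by rw [updateCol_ne (hne₀ j hj), hJ i j hj]) hj₀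
    (k := k) (by rwa [updateCol_self])
  set G := (H.updateCol j₀ g * Q.map Polynomial.C).updateCol j₀ fun i => g i * X with hG
  have hcol : ∀ i, ((g i * X).natDegree ≤ d i ∧ (g i).natDegree ≤ d i) := fun i => by
    by_cases hi : g i = 0
    · simp [hi]
    · have := hdeg i hi
      exact ⟨(Polynomial.natDegree_mul_X hi).trans_le (by omega), by omega⟩
  have hGd : ∀ i j, (G i j).natDegree ≤ d i :=
    natDegree_updateCol_le (natDegree_mul_map_C_le
      (natDegree_updateCol_le hd j₀ fun i => (hcol i).2) Q) j₀ fun i => (hcol i).1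
  have hGk : ∀ j, (G k j).coeff 0 = 0 := fun j => by
    refine (em (j = j₀)).elim (fun hj => by simp [hG, hj]) fun hj => ?_
    rw [hG, updateCol_ne hj, hQk j hj]
  obtain ⟨H', d', hd', hJ', hsum, hGH'⟩ := exists_rowSpan_eq_of_coeff_zero_eq_zero hGd
    (fun i j hj => by rw [hG, updateCol_ne (hne₀ j hj), hQJ i j hj]) (pos_of_gt hdk) hGk
  have hs : s + 1 ≤ ∑ i, d i :=
    (by omega : s + 1 ≤ d k).trans (Finset.single_le_sum_of_canonicallyOrdered (Finset.mem_univ k))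
  refine ⟨_, _, (((ColumnReduction.delay J (Pi.single j₀ (-(s : ℤ)))).mul hQ).mul
    (.delay J (Pi.single j₀ 1))).mono subset_rfl (by simp) ?_, H', d', hd', hJ', hsum, ?_⟩
  · simpa [Pi.single_apply, apply_ite] using hs
  · rw [hGH', ← rowSpan_mul, ← Matrix.mul_assoc, ← Matrix.mul_assoc,
      map_toLaurent_mul_delay (g := g) fun i => by simp [hg], map_toLaurent_mul_map_C,
      map_toLaurent_mul_delay (g := fun i => g i * X) fun i => by
        rw [hQj₀, updateCol_self, map_mul, Polynomial.toLaurent_X]]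

/-- `M` becomes a coordinate submodule by a column reduction of the given size within `J`. -/
def Reducible (J : Finset (Fin n)) (N K : ℕ) (M : Submodule F[T;T⁻¹] (Fin n → F[T;T⁻¹])) : Prop :=
  ∃ U V, ColumnReduction J N K U V ∧
    ∃ I ⊆ J, M.map U.vecMulLinear = Pi.spanSubset F[T;T⁻¹] (I : Set (Fin n))

theorem Reducible.of_map {M : Submodule F[T;T⁻¹] (Fin n → F[T;T⁻¹])} {J' : Finset (Fin n)}
    {N K N₁ K₁ N₂ K₂ : ℕ} {U V : Matrix (Fin n) (Fin n) F[T;T⁻¹]}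
    (hU : ColumnReduction J N₁ K₁ U V) (hM : Reducible J' N₂ K₂ (M.map U.vecMulLinear))
    (hJ : J' ⊆ J) (hN : N₁ + N₂ ≤ N) (hK : K₁ + K₂ ≤ K) : Reducible J N K M := by
  obtain ⟨U', V', hU', I, hI, hMI⟩ := hM
  exact ⟨U * U', V * V', (hU.mul (hU'.mono hJ le_rfl le_rfl)).mono subset_rfl hN hK, I,
    hI.trans hJ, by rw [← map_vecMulLinear_map, hMI]⟩

theorem reducible_rowSpan (hd : ∀ i j, (H i j).natDegree ≤ d i) (hJ : ∀ i, ∀ j ∉ J, H i j = 0)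
    (hsat : Saturated (rowSpan (H.map toLaurent))) :
    Reducible J (n * J.card + 2 * n * ∑ i, d i) ((∑ i, d i) ^ 2) (rowSpan (H.map toLaurent)) := by
  induction hm : J.card + ∑ i, d i using Nat.strong_induction_on generalizing J H d with
  | _ m ih => ?_
  by_cases hlead : ∀ a : Fin n → F, (∀ j ∉ J, a j = 0) → coeffMatrix H d *ᵥ a = 0 → a = 0
  · exact ⟨1, 1, .one _ _, J, subset_rfl, by
      rw [map_vecMulLinear_one]; exact rowSpan_eq_spanSubset_of_coeffMatrix hd hJ hsat hlead⟩
  push Not at hlead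
  obtain ⟨a, haJ, hlead, ha⟩ := hlead
  obtain ⟨j₀, hj₀, Q, Q', hQ, hQJ, hlow⟩ := exists_coeffMatrix_col_eq_zero hJ haJ ha hlead
  have hn : J.card ≤ n := J.card_le_univ.trans_eq (Fintype.card_fin n)
  set G := H * Q.map Polynomial.C
  have hGd : ∀ i j, (G i j).natDegree ≤ d i := natDegree_mul_map_C_le hd Q
  have hHG : (rowSpan (H.map toLaurent)).map (Q.map LaurentPolynomial.C).vecMulLinear =
      rowSpan (G.map toLaurent) := by rw [← rowSpan_mul, map_toLaurent_mul_map_C]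
  have hGsat : Saturated (rowSpan (G.map toLaurent)) :=
    hHG ▸ hsat.map_vecMulLinear hQ.isUnit
  by_cases hne : (fun i => G i j₀) = 0
  · have hcard := Finset.card_erase_add_one hj₀
    have hGJ : ∀ i, ∀ j ∉ J.erase j₀, G i j = 0 := fun i j hj => by
      by_cases hjj : j = j₀
      · exact hjj ▸ congrFun hne i
      · exact hQJ i j fun h => hj (Finset.mem_erase.2 ⟨hjj, h⟩)
    refine .of_map hQ (hHG ▸ ih _ (by omega) hGd hGJ hGsat rfl) (Finset.erase_subset j₀ J) ?_
      (Nat.zero_add _).le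
    nlinarith
  · obtain ⟨U, V, hU, H', d', hd', hJ', hsum, hGH'⟩ :=
      exists_degree_reduction hGd hQJ hj₀ hlow hne
    have hH'sat : Saturated (rowSpan (H'.map toLaurent)) :=
      hGH' ▸ hGsat.map_vecMulLinear hU.isUnit
    have hHH' : (rowSpan (H.map toLaurent)).map (Q.map LaurentPolynomial.C * U).vecMulLinear =
        rowSpan (H'.map toLaurent) := by rw [← map_vecMulLinear_map, hHG, hGH']
    have hred := ih _ (by omega) hd' hJ' hH'sat rfl
    have := Nat.zero_le (∑ i, d' i)
    rw [← hHH'] at hred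
    refine .of_map (hQ.mul hU) hred subset_rfl ?_ ?_ <;> rw [← hsum] <;> nlinarith

end Reduction

/-! ### Exponents and non-catastrophic matrices -/

section Exponents

variable {F : Type*} [CommRing F]

/-- Only the powers `D ^ s` with `|s| ≤ B` occur in the Laurent polynomial `f`. -/
def ExponentsWithin (B : ℕ) (f : F[T;T⁻¹]) : Prop :=
  ∃ p : F[X], p.natDegree ≤ 2 * B ∧ toLaurent p = T B * f

variable {B K : ℕ} {f g : F[T;T⁻¹]}

theorem ExponentsWithin.add (hf : ExponentsWithin B f) (hg : ExponentsWithin B g) :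
    ExponentsWithin B (f + g) := by
  obtain ⟨p, hp, hpf⟩ := hf
  obtain ⟨q, hq, hqg⟩ := hg
  exact ⟨p + q, Polynomial.natDegree_add_le_of_degree_le hp hq, by rw [map_add, hpf, hqg, mul_add]⟩

theorem ExponentsWithin.mul_C (hf : ExponentsWithin B f) (c : F) :
    ExponentsWithin B (f * LaurentPolynomial.C c) := by
  obtain ⟨p, hp, hpf⟩ := hf
  exact ⟨p * Polynomial.C c, (Polynomial.natDegree_mul_C_le p c).trans hp, by
    rw [map_mul, hpf, Polynomial.toLaurent_C, mul_assoc]⟩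

theorem ExponentsWithin.mul_T (hf : ExponentsWithin B f) {ℓ : ℤ} (hℓ : ℓ.natAbs ≤ K) :
    ExponentsWithin (B + K) (f * T ℓ) := by
  obtain ⟨p, hp, hpf⟩ := hf
  obtain ⟨m, hm⟩ := Int.eq_ofNat_of_zero_le (show 0 ≤ K + ℓ by omega)
  refine ⟨p * X ^ m, (Polynomial.natDegree_mul_le_of_le hp (Polynomial.natDegree_X_pow_le m)).trans
    (by omega), ?_⟩
  have hm' : ((m : ℕ) : ℤ) = K + ℓ := hm.symm
  rw [map_mul, hpf, Polynomial.toLaurent_X_pow, hm', Nat.cast_add, T_add, T_add]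
  ring

theorem ExponentsWithin.mono (hf : ExponentsWithin B f) (h : B ≤ K) : ExponentsWithin K f := by
  obtain ⟨K, rfl⟩ := Nat.exists_eq_add_of_le h
  simpa only [T_zero, mul_one] using hf.mul_T (ℓ := 0) (Nat.zero_le K)

theorem exponentsWithin_toLaurent {p : F[X]} (hp : p.natDegree ≤ B) :
    ExponentsWithin B (toLaurent p) :=
  ⟨X ^ B * p, (Polynomial.natDegree_mul_le_of_le (Polynomial.natDegree_X_pow_le B) hp).trans_eq
    (two_mul B).symm, by rw [map_mul, Polynomial.toLaurent_X_pow]⟩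

theorem ColumnReduction.exponentsWithin_vecMul {n N : ℕ} {J : Finset (Fin n)}
    {U V : Matrix (Fin n) (Fin n) F[T;T⁻¹]} (h : ColumnReduction J N K U V)
    {v : Fin n → F[T;T⁻¹]} (hv : ∀ j, ExponentsWithin B (v j)) (j : Fin n) :
    ExponentsWithin (B + K) ((v ᵥ* U) j) := by
  induction h generalizing B v with
  | one => simpa only [vecMul_one] using (hv j).mono (Nat.le_add_right B _)
  | @transvection_mul _ _ _ _ i k _ _ _ c _ ih =>
    rw [← vecMul_vecMul]
    refine ih fun l => ?_
    rw [← mul_one (LaurentPolynomial.C c), transvection_mul_eq_one_add_vecMulVec, vecMul_add,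
      vecMul_one, vecMul_vecMulVec, dotProduct_single]
    by_cases hl : l = k
    · subst hl
      simpa using (hv l).add ((hv i).mul_C c)
    · simpa [hl] using hv l
  | @delay_mul _ K _ _ a _ ih =>
    rw [← vecMul_vecMul, Nat.add_comm K, ← Nat.add_assoc]
    refine ih fun l => ?_
    rw [QCC.delay, vecMul_diagonal]
    exact (hv l).mul_T (Finset.single_le_sum_of_canonicallyOrdered
      (f := fun l => (a l).natAbs) (Finset.mem_univ l))

theorem reducible_rowSpan_of_exponentsWithin {F ι : Type*} [Field F] [Fintype ι] {n B : ℕ}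
    {J : Finset (Fin n)} {W : Matrix ι (Fin n) F[T;T⁻¹]} (hB : ∀ i j, ExponentsWithin B (W i j))
    (hJ : ∀ i, ∀ j ∉ J, W i j = 0) (hsat : Saturated (rowSpan W)) :
    Reducible J (n * J.card + 2 * n * (Fintype.card ι * (2 * B)))
      ((Fintype.card ι * (2 * B)) ^ 2) (rowSpan W) := by
  classical
  choose H hdeg hHW using hB
  have hspan : rowSpan (Matrix.map H toLaurent) = rowSpan W := by
    rw [← rowSpan_mul_of_isUnit
      ((isUnit_diagonal (v := fun _ : ι => T B)).2 (Pi.isUnit_iff.2 fun _ => isUnit_T B)) W]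
    congr 1
    ext1 i j
    rw [diagonal_mul]
    exact hHW i j
  rw [← hspan] at hsat ⊢
  simpa using reducible_rowSpan (d := fun _ => 2 * B) hdeg (fun i j hj =>
    Polynomial.toLaurent_injective (by simp [hHW, hJ i j hj])) hsat

end Exponents

section NonCatastrophic

variable {F : Type*} [Field F] {r n : ℕ} {H : Matrix (Fin r) (Fin n) F[X]}

theorem NonCatastrophic.exists_vecMul_eq (hH : NonCatastrophic H) {q : F[X]} (hq : q.coeff 0 ≠ 0)
    {u : Fin r → F[X]} {w : Fin n → F[X]} (huw : u ᵥ* H = q • w) : ∃ u', u' ᵥ* H = w := by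
  let φ : F[X] →+* PowerSeries F := Polynomial.coeToPowerSeries.ringHom
  have hφ : Function.Injective φ := Polynomial.coe_injective F
  have hqinv : (φ q)⁻¹ * φ q = 1 := PowerSeries.inv_mul_cancel _ (by simpa [φ] using hq)
  have hw : ∀ j, ∑ i, (φ q)⁻¹ * φ (u i) * φ (H i j) = φ (w j) := fun j => by
    have h : ∑ i, u i * H i j = q * w j := congrFun huw j
    simp_rw [mul_assoc, ← Finset.mul_sum, ← map_mul, ← map_sum, h, map_mul, ← mul_assoc, hqinv,
      one_mul]
  choose u' hu' using hH _ fun j => ⟨w j, hw j⟩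
  refine ⟨u', funext fun j => hφ ?_⟩
  rw [← hw, vecMul, dotProduct, map_sum]
  exact Finset.sum_congr rfl fun i _ => by rw [map_mul, hu']; rfl

theorem NonCatastrophic.saturated (hH : NonCatastrophic H) :
    Saturated (rowSpan (H.map toLaurent)) := by
  rintro a v ha ⟨u, hu⟩
  obtain ⟨N, b, hb⟩ := exists_toLaurent_eq_T_smul fun _ : Unit => a
  obtain ⟨s, q, ⟨⟩, hbq, hq⟩ := exists_eq_X_pow_mul (p := b) fun h => ha <|
    (isUnit_T (N : ℤ)).mul_right_eq_zero.1 (by rw [← hb (), h, Pi.zero_apply, map_zero])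
  obtain ⟨L, p, hp⟩ := exists_toLaurent_eq_T_smul (Sum.elim u v)
  obtain ⟨u', hu'⟩ := hH.exists_vecMul_eq hq (u := fun i => X ^ N * p (Sum.inl i))
    (w := fun j => X ^ s * p (Sum.inr j)) <| funext fun j => Polynomial.toLaurent_injective <| by
      have huj : ∑ i, u i * toLaurent (H i j) = a * v j := congrFun hu j
      have hqa : toLaurent (q ()) * T s = T N * a := by
        rw [← hb (), hbq, map_mul, Polynomial.toLaurent_X_pow]
      calc toLaurent (∑ i, X ^ N * p (Sum.inl i) * H i j)
          = T N * T L * ∑ i, u i * toLaurent (H i j) := by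
            simp only [map_sum, map_mul, hp, Polynomial.toLaurent_X_pow, Sum.elim_inl, mul_assoc,
              Finset.mul_sum]
        _ = toLaurent (q ()) * T s * (T L * v j) := by rw [huj, hqa]; ring
        _ = toLaurent (q () * (X ^ s * p (Sum.inr j))) := by
            rw [map_mul, map_mul, hp, Polynomial.toLaurent_X_pow, Sum.elim_inr, mul_assoc]
  have hmem : (T (s + L) : F[T;T⁻¹]) • v ∈ rowSpan (H.map toLaurent) := by
    refine ⟨fun i => toLaurent (u' i), funext fun j => ?_⟩
    have h := congrArg toLaurent (congrFun hu' j)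
    rw [map_mul, hp, Polynomial.toLaurent_X_pow, ← mul_assoc, ← T_add] at h
    refine Eq.trans ?_ h
    simp [vecMul, dotProduct]
  exact (Submodule.smul_mem_iff_of_isUnit _ (isUnit_T (s + L))).1 hmem

theorem NonCatastrophic.fullRank (hH : NonCatastrophic H) : FullRank H := by
  refine Matrix.vecMul_injective_iff.1 <|
    (injective_iff_map_eq_zero H.vecMulLinear).2 fun u hu => by_contra fun hne => ?_
  obtain ⟨i, hi⟩ := Function.ne_iff.1 hne
  let φ : F[X] →+* PowerSeries F := Polynomial.coeToPowerSeries.ringHom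
  have hφ : Function.Injective φ := Polynomial.coe_injective F
  set q := 1 - X * u i with hqdef
  have hqinv : φ q * (φ q)⁻¹ = 1 := PowerSeries.mul_inv_cancel _ (by simp [φ, q])
  obtain ⟨p, hp⟩ := hH (fun k => (φ q)⁻¹ * φ (u k)) (fun j => ⟨0, by
    have h : ∑ k, u k * H k j = 0 := congrFun hu j
    have : ∑ k, (φ q)⁻¹ * φ (u k) * φ (H k j) = 0 := by
      simp_rw [mul_assoc, ← Finset.mul_sum, ← map_mul, ← map_sum, h, map_zero, mul_zero]
    rw [Polynomial.coe_zero]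
    exact this⟩) i
  have hpq : u i = q * p := hφ <| by
    rw [map_mul]; change _ = _ * (p : PowerSeries F)
    rw [← hp, ← mul_assoc, hqinv, one_mul]
  have hdeg : q.natDegree = (u i).natDegree + 1 := by
    rw [hqdef, Polynomial.natDegree_sub_eq_right_of_natDegree_lt, Polynomial.natDegree_X_mul hi]
    rw [Polynomial.natDegree_one, Polynomial.natDegree_X_mul hi]
    exact Nat.succ_pos _
  have := Polynomial.natDegree_le_of_dvd ⟨p, hpq⟩ hi
  omega

end NonCatastrophic

/-! ### Simultaneous reduction of a pair of dual matrices -/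

section DualPair

variable {F : Type*} [Field F] {n r₁ k₂ : ℕ} {H₁ : Matrix (Fin r₁) (Fin n) F[X]}
  {H₂ : Matrix (Fin k₂) (Fin n) F[X]}

theorem FullRank.vecMul_injective (hH : FullRank H₁) :
    Function.Injective (H₁.map toLaurent).vecMulLinear := by
  refine (injective_iff_map_eq_zero _).2 fun u hu => ?_
  obtain ⟨N, p, hp⟩ := exists_toLaurent_eq_T_smul u
  have hpH : p ᵥ* H₁ = 0 := funext fun j => Polynomial.toLaurent_injective <| by
    have huj : ∑ i, u i * toLaurent (H₁ i j) = 0 := congrFun hu j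
    simp only [vecMul, dotProduct, map_sum, map_mul, hp, mul_assoc, ← Finset.mul_sum, huj,
      mul_zero, Pi.zero_apply, map_zero]
  have hp0 : p = 0 := Matrix.vecMul_injective_iff.2 hH (hpH.trans (zero_vecMul H₁).symm)
  exact funext fun i => (isUnit_T (N : ℤ)).mul_right_eq_zero.1
    (by rw [← hp, hp0, Pi.zero_apply, map_zero])

theorem FullRank.card_eq (hH : FullRank H₁) {A : Matrix (Fin n) (Fin n) F[T;T⁻¹]} (hA : IsUnit A)
    {I : Finset (Fin n)}
    (hI : (rowSpan (H₁.map toLaurent)).map A.vecMulLinear = Pi.spanSubset F[T;T⁻¹] I) :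
    I.card = r₁ := by
  have hinj : Function.Injective A.vecMulLinear := Matrix.vecMul_injective_of_isUnit hA
  rw [← Set.ncard_coe_finset, ← Pi.dim_spanSubset (R := F[T;T⁻¹]), ← hI,
    ← (Submodule.equivMapOfInjective _ hinj _).finrank_eq, rowSpan,
    LinearMap.finrank_range_of_inj hH.vecMul_injective, Module.finrank_fin_fun]

theorem FullRank.le (hH : FullRank H₁) : r₁ ≤ n := by
  simpa using LinearMap.finrank_le_finrank_of_injective hH.vecMul_injective

theorem invert_seqInner (v w : Fin n → F[T;T⁻¹]) :
    LaurentPolynomial.invert (seqInner v w) = seqInner w v := by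
  simp only [seqInner, map_sum, map_mul]
  exact Finset.sum_congr rfl fun j _ => by
    rw [LaurentPolynomial.involutive_invert (w j), mul_comm]

theorem rowSpan_le_dualCode_parityCode (H : Matrix (Fin k₂) (Fin n) F[X]) :
    rowSpan (H.map toLaurent) ≤ dualCode (parityCode H) := by
  rintro _ ⟨u, rfl⟩
  rw [vecMulLinear_apply, vecMul_eq_sum]
  refine Submodule.sum_mem _ fun i _ => Submodule.smul_mem _ _ fun c hc => ?_
  rw [← invert_seqInner]
  exact (congrArg _ (hc i)).trans (map_zero _)

theorem IsContragredient.vecMul_apply_eq_zero {U V : Matrix (Fin n) (Fin n) F[T;T⁻¹]}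
    (h : IsContragredient U V) {M : Submodule F[T;T⁻¹] (Fin n → F[T;T⁻¹])} {J : Set (Fin n)}
    (hM : M.map U.vecMulLinear = Pi.spanSubset F[T;T⁻¹] J) {w : Fin n → F[T;T⁻¹]}
    (hw : ∀ v ∈ M, seqInner v w = 0) {j : Fin n} (hj : j ∈ J) : (w ᵥ* V) j = 0 := by
  have hmem : Pi.single j 1 ∈ M.map U.vecMulLinear :=
    hM ▸ Pi.mem_spanSubset_iff.2 fun i hi => Pi.single_eq_of_ne (fun (h : i = j) => hi (h ▸ hj)) 1
  obtain ⟨v, hv, hvj⟩ := hmem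
  have h0 : seqInner (Pi.single j 1) (w ᵥ* V) = 0 := by
    rw [← hvj, vecMulLinear_apply, h.seqInner_vecMul, hw v hv]
  simpa [seqInner, Pi.single_apply] using h0

theorem exists_simultaneous_reduction {ν : ℕ} (hd₁ : ∀ i j, (H₁ i j).natDegree ≤ ν)
    {d : Fin k₂ → ℕ} (hd₂ : ∀ i j, (H₂ i j).natDegree ≤ d i) (hν : ∑ i, d i ≤ ν)
    (hH₁ : NonCatastrophic H₁) (hH₂ : NonCatastrophic H₂)
    (hdual : dualCode (parityCode H₂) ≤ parityCode H₁) :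
    ∃ (K : ℕ) (U V : Matrix (Fin n) (Fin n) F[T;T⁻¹]) (J₁ J₂ : Finset (Fin n)),
      ColumnReduction Finset.univ
        ((n * n + 2 * n * ν) + (n * n + 2 * n * (n * (2 * (ν + ν ^ 2))))) K U V ∧
      Disjoint J₁ J₂ ∧
      (rowSpan (H₁.map toLaurent)).map V.vecMulLinear = Pi.spanSubset F[T;T⁻¹] J₁ ∧
      (rowSpan (H₂.map toLaurent)).map U.vecMulLinear = Pi.spanSubset F[T;T⁻¹] J₂ := by
  have hcard : ∀ J : Finset (Fin n), J.card ≤ n := fun J =>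
    J.card_le_univ.trans_eq (Fintype.card_fin n)
  obtain ⟨U, V, hUV, J₂, -, hJ₂⟩ := reducible_rowSpan (J := Finset.univ) hd₂
    (fun i j hj => absurd (Finset.mem_univ j) hj) hH₂.saturated
  set W := H₁.map toLaurent * V
  have hexp : ∀ i j, ExponentsWithin (ν + ν ^ 2) (W i j) := fun i j =>
    (hUV.symm.exponentsWithin_vecMul (fun j => exponentsWithin_toLaurent (hd₁ i j)) j).mono
      (by gcongr)
  have hzero : ∀ i, ∀ j ∉ J₂ᶜ, W i j = 0 := fun i j hj =>
    hUV.isContragredient.vecMul_apply_eq_zero hJ₂ (fun v hv => by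
      rw [← invert_seqInner]
      exact (congrArg _ (hdual (rowSpan_le_dualCode_parityCode H₂ hv) i)).trans (map_zero _))
      (Finset.notMem_compl.1 hj)
  have hWsat : Saturated (rowSpan W) :=
    rowSpan_mul (H₁.map toLaurent) V ▸ hH₁.saturated.map_vecMulLinear hUV.symm.isUnit
  obtain ⟨V', U', hVU', J₁, hJ₁J₂, hJ₁⟩ := reducible_rowSpan_of_exponentsWithin hexp hzero hWsat
  refine ⟨_, U * U', V * V', J₁, J₂,
    (hUV.mul (hVU'.symm.mono (Finset.subset_univ _) le_rfl le_rfl)).mono subset_rfl ?_ le_rfl,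
    Finset.disjoint_of_subset_left hJ₁J₂ disjoint_compl_left, ?_, ?_⟩
  · rw [Fintype.card_fin]
    gcongr
    exacts [hcard _, hcard _, hH₁.fullRank.le]
  · rw [← map_vecMulLinear_map, ← rowSpan_mul, hJ₁]
  · rw [← map_vecMulLinear_map, hJ₂, hVU'.symm.map_spanSubset_of_disjoint disjoint_compl_right]

theorem natDegree_le_constraintLength (H₁ : Matrix (Fin r₁) (Fin n) F[X])
    (H₂ : Matrix (Fin k₂) (Fin n) F[X]) (i : Fin r₁) (j : Fin n) :
    (H₁ i j).natDegree ≤ constraintLength (cssStabilizer H₁ H₂) :=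
  (Finset.le_sup (f := fun j => (cssStabilizer H₁ H₂ (Sum.inr i) j).natDegree)
    (Finset.mem_univ (Sum.inr j))).trans (Finset.single_le_sum_of_canonicallyOrdered
      (f := fun i => Finset.univ.sup fun j => (cssStabilizer H₁ H₂ i j).natDegree)
      (Finset.mem_univ (Sum.inr i)))

theorem sum_sup_natDegree_le_constraintLength (H₁ : Matrix (Fin r₁) (Fin n) F[X])
    (H₂ : Matrix (Fin k₂) (Fin n) F[X]) :
    ∑ i, (Finset.univ.sup fun j => (H₂ i j).natDegree) ≤
      constraintLength (cssStabilizer H₁ H₂) := by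
  rw [constraintLength, Fintype.sum_sum_type]
  refine le_add_right (Finset.sum_le_sum fun i _ => Finset.sup_le fun j _ => ?_)
  exact Finset.le_sup (f := fun j => (cssStabilizer H₁ H₂ (Sum.inl i) j).natDegree)
    (Finset.mem_univ (Sum.inl j))

end DualPair

/-! ### Submodules that split into an `X`-part and a `Z`-part -/

section SumSubmodule

variable {R ι κ σ τ : Type*} [CommRing R]

/-- The submodule `P ⊕ Q` of the vectors `(X | Z)` with `X`-part in `P` and `Z`-part in `Q`. -/
def sumSubmodule (P : Submodule R (σ → R)) (Q : Submodule R (τ → R)) :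
    Submodule R (σ ⊕ τ → R) :=
  P.comap (LinearMap.funLeft R R Sum.inl) ⊓ Q.comap (LinearMap.funLeft R R Sum.inr)

theorem mem_sumSubmodule {P : Submodule R (σ → R)} {Q : Submodule R (τ → R)} {v : σ ⊕ τ → R} :
    v ∈ sumSubmodule P Q ↔ v ∘ Sum.inl ∈ P ∧ v ∘ Sum.inr ∈ Q := Iff.rfl

theorem sumSubmodule_spanSubset [Finite σ] [Finite τ] (I : Set σ) (J : Set τ) :
    sumSubmodule (Pi.spanSubset R I) (Pi.spanSubset R J) =
      Pi.spanSubset R (Sum.inl '' I ∪ Sum.inr '' J) := by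
  ext v
  simp only [mem_sumSubmodule, Pi.mem_spanSubset_iff, Function.comp_apply, Sum.forall,
    Set.mem_union, Set.mem_image, Sum.inl.injEq, Sum.inr.injEq, exists_eq_right, reduceCtorEq,
    and_false, exists_false, or_false, false_or]

variable [Fintype ι] [Fintype κ]

theorem map_sumSubmodule_fromBlocks (P : Submodule R (ι → R)) (Q : Submodule R (κ → R))
    (A : Matrix ι σ R) (B : Matrix κ τ R) :
    (sumSubmodule P Q).map (fromBlocks A 0 0 B).vecMulLinear =
      sumSubmodule (P.map A.vecMulLinear) (Q.map B.vecMulLinear) := by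
  ext w
  simp only [Submodule.mem_map, mem_sumSubmodule, vecMulLinear_apply, vecMul_fromBlocks,
    vecMul_zero, add_zero, zero_add]
  constructor
  · rintro ⟨v, ⟨hP, hQ⟩, rfl⟩
    exact ⟨⟨_, hP, rfl⟩, ⟨_, hQ, rfl⟩⟩
  · rintro ⟨⟨x, hx, hxw⟩, ⟨z, hz, hzw⟩⟩
    exact ⟨Sum.elim x z, ⟨hx, hz⟩, by
      rw [Sum.elim_comp_inl, Sum.elim_comp_inr, hxw, hzw, Sum.elim_comp_inl_inr]⟩

theorem rowSpan_fromBlocks (A : Matrix ι σ R) (B : Matrix κ τ R) :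
    rowSpan (fromBlocks A 0 0 B) = sumSubmodule (rowSpan A) (rowSpan B) := by
  simp only [rowSpan, LinearMap.range_eq_map, ← map_sumSubmodule_fromBlocks]
  congr 1
  exact (eq_top_iff.2 fun _ _ => ⟨trivial, trivial⟩).symm

end SumSubmodule

section Stabilizer

variable {F : Type*} [Field F] {n : ℕ}

theorem stabilizerSpan_eq_rowSpan {ρ : Type*} [Fintype ρ]
    (S : Matrix ρ (Fin n ⊕ Fin n) F[T;T⁻¹]) : stabilizerSpan S = rowSpan S :=
  (range_vecMulLinear S).symm

theorem stabilizerSpan_cssStabilizer {r₁ k₂ : ℕ} (H₁ : Matrix (Fin r₁) (Fin n) F[X])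
    (H₂ : Matrix (Fin k₂) (Fin n) F[X]) :
    stabilizerSpan ((cssStabilizer H₁ H₂).map toLaurent) =
      sumSubmodule (rowSpan (H₂.map toLaurent)) (rowSpan (H₁.map toLaurent)) := by
  rw [stabilizerSpan_eq_rowSpan, cssStabilizer, fromBlocks_map, Matrix.map_zero _ (map_zero _),
    Matrix.map_zero _ (map_zero _), rowSpan_fromBlocks]

theorem stabilizerSpan_trivialStabilizer {r : ℕ} (hr : r ≤ n) :
    stabilizerSpan (trivialStabilizer F n r) =
      sumSubmodule (Pi.spanSubset F[T;T⁻¹] ∅)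
        (Pi.spanSubset F[T;T⁻¹] (Set.range (Fin.castLE hr))) := by
  have hrow : ∀ i, trivialStabilizer F n r i = Pi.single (Sum.inr (Fin.castLE hr i)) 1 :=
    fun i => by
      ext (j | j)
      · simp [trivialStabilizer]
      · simp [trivialStabilizer, Pi.single_apply, Fin.ext_iff, eq_comm]
  rw [sumSubmodule_spanSubset, Set.image_empty, Set.empty_union, Pi.spanSubset, ← Set.range_comp,
    ← Set.range_comp, stabilizerSpan]
  simp only [hrow, Function.comp_def, Pi.basisFun_apply]

end Stabilizer

/-! ### Circuits -/

section Circuit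

variable {F : Type*} [Field F] {n : ℕ}

/-- The copies of the gate in the frames of a stream act on disjoint sets of qudits, so that they
can be executed simultaneously. -/
def Gate.IsParallel (g : Gate F n) : Prop :=
  ∀ N : ℕ, (g.unroll N).Pairwise fun a b => Disjoint a.support b.support

theorem framePositions_pairwise_ne (N : ℕ) (ℓ : ℤ) : (framePositions N ℓ).Pairwise (· ≠ ·) := by
  refine List.Pairwise.filter _ ?_
  simpa [List.bind_eq_flatMap, ← List.map_eq_flatMap, List.Nodup, Function.comp_def] using
    (List.nodup_range (n := N)).map (Nat.cast_injective (R := ℤ))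

theorem Gate.isParallel_dft (i : Fin n) : (Gate.dft i : Gate F n).IsParallel := fun N =>
  (framePositions_pairwise_ne N 0).map _ fun s t hst => by simp [QuditGate.support, hst]

theorem Gate.isParallel_mult (i : Fin n) (γ : Fˣ) : (Gate.mult i γ).IsParallel := fun N =>
  (framePositions_pairwise_ne N 0).map _ fun s t hst => by simp [QuditGate.support, hst]

theorem Gate.isParallel_add {i j : Fin n} (ℓ : ℤ) (h : i ≠ j) :
    (Gate.add i j ℓ h : Gate F n).IsParallel := fun N =>
  (framePositions_pairwise_ne N ℓ).map _ fun s t hst => by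
    simp [QuditGate.support, hst.symm, h, h.symm]

theorem Circuit.matrix_append (c c' : Circuit F n) :
    Circuit.matrix (c ++ c') = Circuit.matrix c * Circuit.matrix c' := by
  simp only [Circuit.matrix, List.map_append, List.prod_append]

theorem diagonal_mul_transvection {R σ : Type*} [CommRing R] [Fintype σ] [DecidableEq σ]
    {d : σ → R} {j : σ} {e : R} (he : e * d j = 1) (i : σ) (c : R) :
    diagonal d * transvection i j c = transvection i j (d i * c * e) * diagonal d := by
  rw [transvection, transvection, mul_add, add_mul, mul_one, one_mul]
  congr 1
  ext k l
  by_cases hl : j = l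
  · subst hl
    by_cases hk : i = k
    · simp [mul_assoc, he, hk]
    · simp [hk, Ne.symm hk]
  · simp [hl]

theorem diagonal_mul_transvection_mul_diagonal {R σ : Type*} [CommRing R] [Fintype σ]
    [DecidableEq σ] {d e : σ → R} (he : ∀ k, d k * e k = 1) (i j : σ) (c : R) :
    diagonal d * (transvection i j c * diagonal e) = transvection i j (d i * c * e j) := by
  rw [← mul_assoc, diagonal_mul_transvection ((mul_comm _ _).trans (he j)), mul_assoc,
    diagonal_mul_diagonal, funext he, diagonal_one, mul_one]

theorem Gate.matrix_mult (i : Fin n) (γ : Fˣ) :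
    (Gate.mult i γ).matrix =
      fromBlocks (diagonal (Function.update 1 i (LaurentPolynomial.C ((γ⁻¹ : Fˣ) : F)))) 0 0
        (diagonal (Function.update 1 i (LaurentPolynomial.C (γ : F)))) := by
  rw [Gate.matrix, singleQudit, single_zero]

theorem Gate.matrix_add {i j : Fin n} (ℓ : ℤ) (h : i ≠ j) :
    (Gate.add i j ℓ h : Gate F n).matrix =
      fromBlocks (transvection i j (T ℓ)) 0 0 (transvection j i (-T (-ℓ))) := by
  rw [Gate.matrix, transvection, transvection, sub_eq_add_neg, single_neg]

theorem exists_circuit_transvection {i j : Fin n} (hij : i ≠ j) (γ : F) (ℓ : ℤ) :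
    ∃ c : Circuit F n, c.length ≤ 3 ∧ (∀ g ∈ c, g.IsParallel) ∧
      Circuit.matrix c = fromBlocks (transvection i j (LaurentPolynomial.C γ * T ℓ)) 0 0
        (transvection j i (LaurentPolynomial.C (-γ) * T (-ℓ))) := by
  obtain rfl | hγ := eq_or_ne γ 0
  · exact ⟨[], by simp, by simp, by simp [Circuit.matrix]⟩
  obtain ⟨u, rfl⟩ := hγ.isUnit
  refine ⟨[.mult i u⁻¹, .add i j ℓ hij, .mult i u], le_rfl, ?_, ?_⟩
  · simp only [List.forall_mem_cons, List.not_mem_nil, IsEmpty.forall_iff, implies_true, and_true]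
    exact ⟨Gate.isParallel_mult _ _, Gate.isParallel_add ℓ hij, Gate.isParallel_mult _ _⟩
  · have hdiag : ∀ w w' : F, w * w' = 1 → ∀ m,
        Function.update (1 : Fin n → F[T;T⁻¹]) i (LaurentPolynomial.C w) m *
          Function.update (1 : Fin n → F[T;T⁻¹]) i (LaurentPolynomial.C w') m = 1 :=
      fun w w' hw m => by
        obtain rfl | hm := eq_or_ne m i
        · simp [← map_mul, hw]
        · simp [hm]
    simp only [Circuit.matrix, List.map_cons, List.map_nil, List.prod_cons, List.prod_nil, mul_one,
      Gate.matrix_add, Gate.matrix_mult, fromBlocks_multiply, Matrix.mul_zero, Matrix.zero_mul,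
      add_zero, zero_add]
    rw [diagonal_mul_transvection_mul_diagonal (hdiag _ _ (by simp)),
      diagonal_mul_transvection_mul_diagonal (hdiag _ _ (by simp))]
    simp [hij.symm]

theorem transvection_mul_delay_mul_transvection (a : Fin n → ℤ) {i j : Fin n} (hij : i ≠ j)
    (γ : F) :
    transvection i j (LaurentPolynomial.C (-γ) * T (a i - a j)) *
      (delay F a * transvection i j (LaurentPolynomial.C γ)) = delay F a := by
  rw [delay, diagonal_mul_transvection (e := T (-a j)) (by rw [← T_add, neg_add_cancel, T_zero]),
    mul_comm (T (a i)), mul_assoc, ← T_add, ← sub_eq_add_neg, ← mul_assoc,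
    transvection_mul_transvection_same _ _ hij, map_neg, neg_mul, neg_add_cancel,
    transvection_zero, one_mul]

/-- The delays are not gates: pushed through the transvections, they end up in the exponents of the
`ADD` gates.  The initial delay `a` is there for the induction. -/
theorem ColumnReduction.exists_circuit {J : Finset (Fin n)} {N K : ℕ}
    {U V : Matrix (Fin n) (Fin n) F[T;T⁻¹]} (h : ColumnReduction J N K U V) (a : Fin n → ℤ) :
    ∃ (c : Circuit F n) (A B : Matrix (Fin n) (Fin n) F[T;T⁻¹]) (b : Fin n → ℤ),
      c.length ≤ 3 * N ∧ (∀ g ∈ c, g.IsParallel) ∧ Circuit.matrix c = fromBlocks A 0 0 B ∧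
      A * (delay F a * U) = delay F b ∧ B * (delay F a * V) = delay F b := by
  induction h generalizing a with
  | one => exact ⟨[], 1, 1, a, by simp, by simp, by simp [Circuit.matrix], by simp, by simp⟩
  | @transvection_mul N _ U V i j _ _ hij γ _ ih =>
    obtain ⟨c, A, B, b, hlen, hpar, hc, hA, hB⟩ := ih a
    obtain ⟨t, htlen, htpar, ht⟩ := exists_circuit_transvection hij (-γ) (a i - a j)
    refine ⟨c ++ t, A * transvection i j (LaurentPolynomial.C (-γ) * T (a i - a j)),
      B * transvection j i (LaurentPolynomial.C (- -γ) * T (-(a i - a j))), b,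
      by rw [List.length_append]; lia, List.forall_mem_append.2 ⟨hpar, htpar⟩,
      by simp only [Circuit.matrix_append, hc, ht, fromBlocks_multiply, Matrix.mul_zero,
        Matrix.zero_mul, add_zero, zero_add], ?_, ?_⟩
    · rw [← mul_assoc (delay F a), mul_assoc A, ← mul_assoc (transvection _ _ _),
        transvection_mul_delay_mul_transvection a hij, hA]
    · rw [← mul_assoc (delay F a), mul_assoc B, ← mul_assoc (transvection _ _ _), neg_sub,
        transvection_mul_delay_mul_transvection a hij.symm, hB]
  | delay_mul a' _ ih =>
    obtain ⟨c, A, B, b, hlen, hpar, hc, hA, hB⟩ := ih (a + a')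
    exact ⟨c, A, B, b, hlen, hpar, hc, by rwa [← mul_assoc (delay F a), delay_mul_delay],
      by rwa [← mul_assoc (delay F a), delay_mul_delay]⟩

theorem ColumnReduction.exists_undoing_circuit {J : Finset (Fin n)} {N K : ℕ}
    {U V : Matrix (Fin n) (Fin n) F[T;T⁻¹]} (h : ColumnReduction J N K U V) :
    ∃ c : Circuit F n, c.length ≤ 3 * N ∧ (∀ g ∈ c, g.IsParallel) ∧
      ∀ (P Q : Submodule F[T;T⁻¹] (Fin n → F[T;T⁻¹])) (I J : Set (Fin n)),
        P.map U.vecMulLinear = Pi.spanSubset F[T;T⁻¹] I →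
        Q.map V.vecMulLinear = Pi.spanSubset F[T;T⁻¹] J →
        (sumSubmodule (Pi.spanSubset F[T;T⁻¹] I) (Pi.spanSubset F[T;T⁻¹] J)).map
          (Circuit.matrix c).vecMulLinear = sumSubmodule P Q := by
  obtain ⟨c, A, B, b, hlen, hpar, hc, hA, hB⟩ := h.exists_circuit 0
  have hundo : ∀ {A U : Matrix (Fin n) (Fin n) F[T;T⁻¹]}, A * (delay F 0 * U) = delay F b →
      IsUnit U → ∀ {P : Submodule F[T;T⁻¹] (Fin n → F[T;T⁻¹])} {I : Set (Fin n)},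
      P.map U.vecMulLinear = Pi.spanSubset F[T;T⁻¹] I →
      (Pi.spanSubset F[T;T⁻¹] I).map A.vecMulLinear = P := fun hA hU P I hP =>
    map_vecMulLinear_injective hU <| by
      rw [delay_zero, one_mul] at hA
      rw [map_vecMulLinear_map, hA, map_delay_spanSubset, hP]
  refine ⟨c, hlen, hpar, fun P Q I J hP hQ => ?_⟩
  rw [hc, map_sumSubmodule_fromBlocks, hundo hA h.isUnit hP, hundo hB h.symm.isUnit hQ]

theorem exists_columnReduction_swap (i j : Fin n) :
    ∃ U V : Matrix (Fin n) (Fin n) F[T;T⁻¹], ColumnReduction Finset.univ 3 0 U V ∧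
      ∀ s : Set (Fin n), (Pi.spanSubset F[T;T⁻¹] s).map V.vecMulLinear =
        Pi.spanSubset F[T;T⁻¹] (Equiv.swap i j '' s) := by
  obtain rfl | hij := eq_or_ne i j
  · exact ⟨1, 1, .one _ _, fun s => by simp [map_vecMulLinear_one]⟩
  have hi := Finset.mem_univ i
  have hj := Finset.mem_univ j
  have hrow : ∀ (x y k : Fin n) (c : F[T;T⁻¹]) (M : Matrix (Fin n) (Fin n) F[T;T⁻¹]),
      (transvection x y c * M) k = if k = x then M x + c • M y else M k := fun x y k c M => by
    ext l
    split_ifs with hk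
    · rw [hk, transvection_mul_apply_same, Pi.add_apply, Pi.smul_apply, smul_eq_mul]
    · rw [transvection_mul_apply_of_ne _ _ _ _ hk]
  refine ⟨_, _, .transvection_mul hj hi hij.symm (-1) (.transvection_mul hi hj hij 1
    (.transvection_mul hj hi hij.symm (-1) (.one 0 0))), fun s =>
      map_spanSubset fun k _ => ⟨if k = j then -1 else 1, ?_⟩⟩
  have hone : ∀ k, (1 : Matrix (Fin n) (Fin n) F[T;T⁻¹]) k = Pi.single k 1 := fun k => by
    ext l
    rw [Matrix.one_apply, Pi.single_apply]
    simp only [eq_comm]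
  simp only [hrow, hone, Equiv.swap_apply_def]
  obtain rfl | hki := eq_or_ne k i
  · simp [hij, hij.symm]
  · obtain rfl | hkj := eq_or_ne k j
    · simp [hij.symm]
    · simp [hki, hkj]

theorem exists_columnReduction_map_spanSubset (A B : Finset (Fin n)) (h : A.card = B.card) :
    ∃ U V : Matrix (Fin n) (Fin n) F[T;T⁻¹],
      ColumnReduction Finset.univ (3 * (A \ B).card) 0 U V ∧
      (Pi.spanSubset F[T;T⁻¹] (A : Set (Fin n))).map V.vecMulLinear =
        Pi.spanSubset F[T;T⁻¹] B := by
  induction hm : (A \ B).card generalizing A with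
  | zero =>
    have hAB : A ⊆ B := Finset.sdiff_eq_empty_iff_subset.1 (Finset.card_eq_zero.1 hm)
    rw [Finset.eq_of_subset_of_card_le hAB h.ge]
    exact ⟨1, 1, .one _ _, map_vecMulLinear_one _⟩
  | succ m ih =>
    obtain ⟨a, ha⟩ : (A \ B).Nonempty := Finset.card_pos.1 (hm ▸ m.succ_pos)
    obtain ⟨b, hb⟩ : (B \ A).Nonempty :=
      Finset.card_pos.1 (Finset.card_sdiff_comm h ▸ hm ▸ m.succ_pos)
    rw [Finset.mem_sdiff] at ha hb
    have hsdiff : A.map (Equiv.swap a b).toEmbedding \ B = (A \ B).erase a := by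
      ext x
      simp only [Finset.mem_sdiff, Finset.mem_map_equiv, Equiv.symm_swap, Finset.mem_erase,
        Equiv.swap_apply_def]
      clear ih hm h
      grind
    obtain ⟨U, V, hUV, hmap⟩ := exists_columnReduction_swap (F := F) a b
    obtain ⟨U', V', hUV', hmap'⟩ := ih _ ((Finset.card_map _).trans h) (by
      rw [hsdiff, Finset.card_erase_of_mem (Finset.mem_sdiff.2 ha), hm, Nat.add_sub_cancel])
    rw [Finset.coe_map] at hmap'
    refine ⟨U * U', V * V', (hUV.mul hUV').mono subset_rfl (by lia) le_rfl, ?_⟩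
    rw [← map_vecMulLinear_map, hmap, ← hmap']
    rfl

theorem Gate.map_dft_spanSubset (i : Fin n) (s : Set (Fin n ⊕ Fin n)) :
    (Pi.spanSubset F[T;T⁻¹] s).map (Gate.dft i : Gate F n).matrix.vecMulLinear =
      Pi.spanSubset F[T;T⁻¹] (Equiv.swap (Sum.inl i) (Sum.inr i) '' s) :=
  map_spanSubset fun k _ => by
    refine ⟨if k = Sum.inl i then -1 else 1, ?_⟩
    funext l
    rcases k with k | k <;> rcases l with l | l <;> obtain rfl | hk := eq_or_ne k i <;>
      simp [Gate.matrix, singleQudit, diagonal_apply, Matrix.single_apply, Pi.single_apply,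
        Equiv.swap_apply_def, Ne.symm, *, eq_comm (a := k) (b := l)]

theorem exists_circuit_dft {I J : Finset (Fin n)} (hIJ : Disjoint I J) :
    ∃ c : Circuit F n, c.length = J.card ∧ (∀ g ∈ c, g.IsParallel) ∧
      (sumSubmodule (Pi.spanSubset F[T;T⁻¹] ∅) (Pi.spanSubset F[T;T⁻¹] (I ∪ J))).map
        (Circuit.matrix c).vecMulLinear =
      sumSubmodule (Pi.spanSubset F[T;T⁻¹] J) (Pi.spanSubset F[T;T⁻¹] I) := by
  induction J using Finset.induction_on generalizing I with
  | empty => exact ⟨[], rfl, by simp, by simp [Circuit.matrix, map_vecMulLinear_one]⟩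
  | insert i J hi ih =>
    rw [Finset.disjoint_insert_right] at hIJ
    obtain ⟨c, hlen, hpar, hc⟩ := ih (I := insert i I) (Finset.disjoint_insert_left.2 ⟨hi, hIJ.2⟩)
    refine ⟨c ++ [.dft i], by simp [hlen, hi], List.forall_mem_append.2
      ⟨hpar, List.forall_mem_singleton.2 (Gate.isParallel_dft i)⟩, ?_⟩
    have hdft : Circuit.matrix [(.dft i : Gate F n)] = (Gate.dft i).matrix := List.prod_singleton
    rw [Circuit.matrix_append, ← map_vecMulLinear_map, Finset.coe_insert, Set.union_insert,
      ← Set.insert_union, ← Finset.coe_insert, hc, hdft, sumSubmodule_spanSubset,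
      Gate.map_dft_spanSubset, sumSubmodule_spanSubset]
    congr 1
    ext x
    simp only [Set.mem_image_equiv, Equiv.symm_swap, Equiv.swap_apply_def]
    rcases x with x | x <;> obtain rfl | hx := eq_or_ne x i <;> simp [*]

end Circuit

/-! ### Depth -/

section Depth

variable {F : Type*} [Field F] {n : ℕ}

theorem RunsInTime.append {g₁ g₂ : List (QuditGate F n)} {d₁ d₂ : ℕ} (h₁ : RunsInTime g₁ d₁)
    (h₂ : RunsInTime g₂ d₂) : RunsInTime (g₁ ++ g₂) (d₁ + d₂) := by
  obtain ⟨τ₁, h₁⟩ := h₁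
  obtain ⟨τ₂, h₂⟩ := h₂
  have hlt : ∀ a : Fin (g₁ ++ g₂).length, ¬ (a : ℕ) < g₁.length → a - g₁.length < g₂.length :=
    fun a ha => by have := a.2.trans_eq List.length_append; lia
  refine ⟨fun a => if h : (a : ℕ) < g₁.length then Fin.castAdd d₂ (τ₁ ⟨a, h⟩)
    else Fin.natAdd d₁ (τ₂ ⟨a - g₁.length, hlt a h⟩), fun a b hab hd => ?_⟩
  have hab' : (a : ℕ) < b := hab
  by_cases hb : (b : ℕ) < g₁.length
  · have ha := hab'.trans hb
    simp only [ha, hb, dif_pos]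
    exact h₁ ⟨a, ha⟩ ⟨b, hb⟩ hab' (by
      simpa [List.getElem_append_left ha, List.getElem_append_left hb] using hd)
  by_cases ha : (a : ℕ) < g₁.length
  · simp only [ha, hb, dif_pos, dif_neg, not_false_iff]
    exact Fin.lt_def.2 (Nat.lt_add_right _ (τ₁ ⟨a, ha⟩).2)
  · simp only [ha, hb, dif_neg, not_false_iff]
    refine (Fin.natAdd_lt_natAdd_iff d₁).2 (h₂ ⟨a - g₁.length, hlt a ha⟩
      ⟨b - g₁.length, hlt b hb⟩ (by rw [Fin.mk_lt_mk]; lia) ?_)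
    simpa [List.getElem_append_right (not_lt.1 ha), List.getElem_append_right (not_lt.1 hb)]
      using hd

theorem RunsInTime.of_pairwise {g : List (QuditGate F n)}
    (h : g.Pairwise fun a b => Disjoint a.support b.support) : RunsInTime g 1 :=
  ⟨fun _ => 0, fun a b hab hd => absurd (List.pairwise_iff_get.1 h a b hab) hd⟩

theorem Circuit.runsInTime_unroll {c : Circuit F n} (hc : ∀ g ∈ c, g.IsParallel) (N : ℕ) :
    RunsInTime (Circuit.unroll N c) c.length := by
  induction c with
  | nil => exact ⟨id, fun a => a.elim0⟩
  | cons g c ih =>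
    rw [List.forall_mem_cons] at hc
    rw [List.length_cons, add_comm]
    exact (RunsInTime.of_pairwise (hc.1 N)).append (ih hc.2)

theorem Circuit.depth_le_length {c : Circuit F n} (hc : ∀ g ∈ c, g.IsParallel) (N : ℕ) :
    Circuit.depth c N ≤ c.length :=
  Nat.sInf_le (Circuit.runsInTime_unroll hc N)

end Depth

/-! ### Encoding circuits -/

section Encoder

variable {F : Type*} [Field F] {n : ℕ}

theorem exists_circuit_map_trivialStabilizer {I J : Finset (Fin n)} (hIJ : Disjoint I J) {r : ℕ}
    (hr : (I ∪ J).card = r) :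
    ∃ c : Circuit F n, c.length ≤ 10 * n ∧ (∀ g ∈ c, g.IsParallel) ∧
      (stabilizerSpan (trivialStabilizer F n r)).map (Circuit.matrix c).vecMulLinear =
        sumSubmodule (Pi.spanSubset F[T;T⁻¹] J) (Pi.spanSubset F[T;T⁻¹] I) := by
  have hcard : ∀ A : Finset (Fin n), A.card ≤ n := fun A =>
    A.card_le_univ.trans_eq (Fintype.card_fin n)
  have hrn : r ≤ n := hr ▸ hcard _
  obtain ⟨U, V, hUV, hV⟩ := exists_columnReduction_map_spanSubset (F := F) (I ∪ J)
    (Finset.univ.map (Fin.castLEEmb hrn)) (by rw [Finset.card_map, Finset.card_fin, hr])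
  obtain ⟨c, hlen, hpar, hc⟩ := hUV.exists_undoing_circuit
  obtain ⟨f, hflen, hfpar, hf⟩ := exists_circuit_dft (F := F) hIJ
  refine ⟨c ++ f, ?_, List.forall_mem_append.2 ⟨hpar, hfpar⟩, ?_⟩
  · rw [List.length_append]
    have := hcard J
    have := hcard ((I ∪ J) \ Finset.univ.map (Fin.castLEEmb hrn))
    lia
  · rw [Circuit.matrix_append, ← map_vecMulLinear_map, stabilizerSpan_trivialStabilizer hrn,
      ← hf, ← Finset.coe_union, ← hc _ _ ∅ _ (by simp [Pi.spanSubset]) hV, Finset.coe_map,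
      Finset.coe_univ, Set.image_univ, Fin.coe_castLEEmb]

theorem exists_isEncoder {r₁ k₂ : ℕ} {H₁ : Matrix (Fin r₁) (Fin n) F[X]}
    {H₂ : Matrix (Fin k₂) (Fin n) F[X]} (hH₁ : NonCatastrophic H₁) (hH₂ : NonCatastrophic H₂)
    (hdual : dualCode (parityCode H₂) ≤ parityCode H₁) {ν : ℕ}
    (hν : constraintLength (cssStabilizer H₁ H₂) = ν) :
    ∃ c : Circuit F n, c.IsEncoder (cssStabilizer H₁ H₂) ∧ (∀ g ∈ c, g.IsParallel) ∧
      c.length ≤ 10 * n +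
        3 * ((n * n + 2 * n * ν) + (n * n + 2 * n * (n * (2 * (ν + ν ^ 2))))) := by
  obtain ⟨K, U, V, J₁, J₂, hUV, hJ, hJ₁, hJ₂⟩ := exists_simultaneous_reduction
    (fun i j => hν ▸ natDegree_le_constraintLength H₁ H₂ i j)
    (fun i j => Finset.le_sup (f := fun j => (H₂ i j).natDegree) (Finset.mem_univ j))
    (hν ▸ sum_sup_natDegree_le_constraintLength H₁ H₂) hH₁ hH₂ hdual
  have hcard : (J₁ ∪ J₂).card = k₂ + r₁ := by
    rw [Finset.card_union_of_disjoint hJ, hH₁.fullRank.card_eq hUV.symm.isUnit hJ₁,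
      hH₂.fullRank.card_eq hUV.isUnit hJ₂, add_comm]
  obtain ⟨c, hlen, hpar, hc⟩ := exists_circuit_map_trivialStabilizer (F := F) hJ hcard
  obtain ⟨c', hlen', hpar', hc'⟩ := hUV.exists_undoing_circuit
  refine ⟨c ++ c', ?_, List.forall_mem_append.2 ⟨hpar, hpar'⟩,
    List.length_append.trans_le (add_le_add hlen hlen')⟩
  rw [Circuit.IsEncoder, stabilizerSpan_cssStabilizer, Fintype.card_sum, Fintype.card_fin,
    Fintype.card_fin, stabilizerSpan_eq_rowSpan, rowSpan_mul, ← stabilizerSpan_eq_rowSpan,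
    Circuit.matrix_append, ← map_vecMulLinear_map, hc, hc' _ _ _ _ hJ₂ hJ₁]

end Encoder

end QCC

theorem mainTheorem1_general :
    ∃ p : MvPolynomial (Fin 2) ℕ,
      ∀ (F : Type*) [Field F] (n r₁ k₂ : ℕ)
        (H₁ : Matrix (Fin r₁) (Fin n) (Polynomial F)) (H₂ : Matrix (Fin k₂) (Fin n) (Polynomial F)),
        QCC.NonCatastrophic H₁ → QCC.NonCatastrophic H₂ →
        QCC.dualCode (QCC.parityCode H₂) ≤ QCC.parityCode H₁ →
        ∃ c : QCC.Circuit F n,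
          QCC.Circuit.IsEncoder c (QCC.cssStabilizer H₁ H₂) ∧
          ∀ N : ℕ, QCC.Circuit.depth c N ≤
            MvPolynomial.eval ![n, QCC.constraintLength (QCC.cssStabilizer H₁ H₂)] p := by
  let x : MvPolynomial (Fin 2) ℕ := MvPolynomial.X 0
  let y : MvPolynomial (Fin 2) ℕ := MvPolynomial.X 1
  refine ⟨10 * x + 3 * ((x * x + 2 * x * y) + (x * x + 2 * x * (x * (2 * (y + y ^ 2))))),
    fun F _ n r₁ k₂ H₁ H₂ hH₁ hH₂ hdual => ?_⟩
  obtain ⟨c, henc, hpar, hlen⟩ := QCC.exists_isEncoder hH₁ hH₂ hdual rfl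
  refine ⟨c, henc, fun N => ((QCC.Circuit.depth_le_length hpar N).trans hlen).trans_eq ?_⟩
  simp only [x, y, map_add, map_mul, map_pow, map_ofNat, MvPolynomial.eval_X, Matrix.cons_val_zero,
    Matrix.cons_val_one]

theorem mainTheorem1 :
    ∃ p : MvPolynomial (Fin 2) ℕ,
      ∀ (F : Type*) [Field F] [Finite F] (n r₁ k₂ : ℕ)
        (H₁ : Matrix (Fin r₁) (Fin n) (Polynomial F)) (H₂ : Matrix (Fin k₂) (Fin n) (Polynomial F)),
        QCC.FullRank H₁ → QCC.NonCatastrophic H₁ → QCC.DelayFree H₁ →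
        QCC.FullRank H₂ → QCC.NonCatastrophic H₂ → QCC.DelayFree H₂ →
        QCC.dualCode (QCC.parityCode H₂) ≤ QCC.parityCode H₁ →
        ∃ c : QCC.Circuit F n,
          QCC.Circuit.IsEncoder c (QCC.cssStabilizer H₁ H₂) ∧
          ∀ N : ℕ, QCC.Circuit.depth c N ≤
            MvPolynomial.eval ![n, QCC.constraintLength (QCC.cssStabilizer H₁ H₂)] p := by
  obtain ⟨p, hp⟩ := mainTheorem1_general
  exact ⟨p, fun F _ _ n r₁ k₂ H₁ H₂ _ hc₁ _ _ hc₂ _ => hp F n r₁ k₂ H₁ H₂ hc₁ hc₂⟩
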